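/- For $n\ge 1$ let $U_0,\dots,U_n$ be i.i.d. uniform on $(0,1)$, let $(a_0,\dots,a_n)$ have the law of $(U_0,\dots,U_n)$ conditioned on the (positive-probability) event that $U_{i-1}U_{i+1}\le U_i^2$ for all $1\le i\le n-1$, and let $(b_0,\dots,b_n)$ be a random vector with the same law as $(a_0^n,\dots,a_n^n)$. Let $P_n(z)=\sum_{i=0}^n b_i z^i$ (the beta model of random log-concave polynomials), and use the convention $\log 0=-\infty$. For $z\in\mathbb{C}\setminus\{0\}$ put \[ G(z)=\begin{cases} 2\log\dfrac{4}{4-\log|z|}, & 0<|z|\le 1,\\[2mm] \log|z|+2\log\dfrac{4}{4+\log|z|}, & |z|\ge 1.\end{cases} \] Then, as $n\to\infty$: (i) for every $z\in\mathbb{C}\setminus\{0\}$, $\frac1n\log|P_n(z)|\to G(z)$ in probability, that is, for every $\varepsilon>0$, $\mathbb{P}\big(\big|\frac1n\log|P_n(z)|-G(z)\big|\ge\varepsilon\big)\to 0$; (ii) for every $C>1$ and every $\varepsilon>0$, \[ \lim_{n\to\infty}\mathbb{P}\Big(\sup_{C^{-1}\le|z|\le C}\Big(\frac1n\log|P_n(z)|-G(z)\Big)\ge\varepsilon\Big)=0.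 \] -/

import Mathlib

open MeasureTheory ProbabilityTheory Filter Topology

noncomputable section

namespace LogConcavePoly

/-- The set of log-concave vectors `(u₀, …, uₙ)`: `u_{j-1} u_{j+1} ≤ u_j ^ 2` for `1 ≤ j ≤ n - 1`. -/
def logConcaveSet (n : ℕ) : Set (Fin (n + 1) → ℝ) :=
  {u | ∀ i j k : Fin (n + 1), (i : ℕ) + 1 = j → (j : ℕ) + 1 = k → u i * u k ≤ u j ^ 2}

/-- The law of `n + 1` i.i.d. random variables with the uniform distribution on `(0, 1)`. -/
def iidUniform (n : ℕ) : Measure (Fin (n + 1) → ℝ) :=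
  Measure.pi fun _ => (volume : Measure ℝ).restrict (Set.Ioo 0 1)

/-- The law of a uniformly chosen log-concave sequence `(a₀, …, aₙ)`: i.i.d. uniform variables
conditioned on the event that they form a log-concave sequence. -/
def uniformModel (n : ℕ) : Measure (Fin (n + 1) → ℝ) :=
  ProbabilityTheory.cond (iidUniform n) (logConcaveSet n)

/-- The law of the coefficient vector `(b₀, …, bₙ) = (a₀ ^ n, …, aₙ ^ n)` of the beta model. -/
def betaModel (n : ℕ) : Measure (Fin (n + 1) → ℝ) :=
  (uniformModel n).map fun a i => a i ^ n

/-- The value at `z` of the polynomial with coefficients `b₀, …, bₙ`. -/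
def evalPoly {n : ℕ} (b : Fin (n + 1) → ℝ) (z : ℂ) : ℂ :=
  ∑ i : Fin (n + 1), (b i : ℂ) * z ^ (i : ℕ)

/-- `(1 / n) log |P(z)|` for `P = b₀ + b₁ z + ⋯ + bₙ zⁿ`, as an extended real number; for `n ≥ 1`
it is `-∞` exactly at the zeros of `P`. -/
def logPotential {n : ℕ} (b : Fin (n + 1) → ℝ) (z : ℂ) : EReal :=
  ENNReal.log ‖evalPoly b z‖ₑ / (n : EReal)

/-- The limiting potential on `ℂ \ {0}` (the value at `0` is never used). -/
def G (z : ℂ) : ℝ :=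
  if ‖z‖ ≤ 1 then 2 * Real.log (4 / (4 - Real.log ‖z‖))
  else Real.log ‖z‖ + 2 * Real.log (4 / (4 + Real.log ‖z‖))

end LogConcavePoly

end

namespace LogConcavePoly

/-! ### The exponential distribution -/

/-! Put `x i = -log (a i)`. The `x i` are i.i.d. exponential of rate 1, conditioned to form a convex
sequence. A nonnegative convex sequence with minimum at `m` is described by its value at `m` and by
the outward slopes and second differences on both sides, all nonnegative. These coordinates are a
unimodular linear image of `x` (`det_baseMap`), and `∑ x i` is a positive combination of them
(`sum_eq_sum_baseMap`). Given the base point `m` they are therefore independent exponentials whose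
rates are the weights, and `m` has probability proportional to the product of the inverse weights
(`iidExp_baseMap`).

The ratio of consecutive masses is explicit, and a summation by parts gives the second moment bound
that puts `m` near `n / 2` (`sum_baseMass_mul_sq_le`). For such `m`, Chebyshev's inequality gives
`-log (a i) → shape t` in probability along `i = ⌊t n⌋`, for `1/2 < t < 1`
(`tendsto_uniformModel_abs_sub_shape`). The terms of `P_n` then have exponential rate `t log |z| -
shape t`, whose maximum is `G z` when `|z| ≥ 1`; reversing the coefficients covers `|z| < 1`.

Upper bound: the limit law at three points around the maximiser and the convexity of `-log a`
control all terms at once (`tendsto_uniformModel_largeTerm`). A finite net in `log |z|` makes this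
uniform on annuli.

Lower bound: fix all coefficients except one of nearly dominant index. A small `|P_n(z)|` confines
that coefficient to an exponentially short interval, whereas the log-concavity constraint usually
leaves it an interval of only polynomially small relative length (`tendsto_uniformModel_lt_mul`,
`uniformModel_smallValue_le`). -/

lemma expMeasure_eq_withDensity (r : ℝ) :
    expMeasure r = volume.withDensity (exponentialPDF r) := rfl

lemma measurable_exponentialPDF (r : ℝ) : Measurable (exponentialPDF r) :=
  (measurable_exponentialPDFReal r).ennreal_ofReal

lemma integrable_exponentialPDFReal {r : ℝ} (hr : 0 < r) :
    Integrable (exponentialPDFReal r) := by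
  refine ⟨(measurable_exponentialPDFReal r).aestronglyMeasurable, ?_⟩
  rw [hasFiniteIntegral_iff_ofReal (Eventually.of_forall (exponentialPDFReal_nonneg hr))]
  have := lintegral_exponentialPDF_eq_one hr
  simp only [exponentialPDF] at this
  rw [this]; exact ENNReal.one_lt_top

/-- A product of exponential distributions has the product density. -/
lemma pi_expMeasure {ι : Type*} [Fintype ι] {w : ι → ℝ} (hw : ∀ i, 0 < w i) :
    Measure.pi (fun i => expMeasure (w i)) =
      volume.withDensity fun y : ι → ℝ => ∏ i, exponentialPDF (w i) (y i) := by
  have := fun i => isProbabilityMeasure_expMeasure (hw i)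
  refine Measure.pi_eq fun s hs => ?_
  rw [withDensity_apply _ (MeasurableSet.univ_pi hs),
    ← lintegral_indicator (MeasurableSet.univ_pi hs)]
  set f : ∀ i, ℝ → ℝ := fun i => (s i).indicator (exponentialPDFReal (w i))
  have hf0 : ∀ i x, 0 ≤ f i x := fun i x =>
    Set.indicator_nonneg (fun _ _ => exponentialPDFReal_nonneg (hw i) _) x
  have hfi : ∀ i, Integrable (f i) := fun i =>
    (integrable_exponentialPDFReal (hw i)).indicator (hs i)
  have h1 : ∀ y : ι → ℝ, (Set.univ.pi s).indicator (fun y => ∏ i, exponentialPDF (w i) (y i)) y =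
      ENNReal.ofReal (∏ i, f i (y i)) := by
    intro y
    rw [ENNReal.ofReal_prod_of_nonneg fun i _ => hf0 i _]
    by_cases hy : y ∈ Set.univ.pi s
    · rw [Set.indicator_of_mem hy]
      refine Finset.prod_congr rfl fun i _ => ?_
      simp only [f, Set.indicator_of_mem (hy i (Set.mem_univ i)), exponentialPDF]
    · rw [Set.indicator_of_notMem hy]
      obtain ⟨i, hi⟩ : ∃ i, y i ∉ s i := by simpa [Set.mem_pi] using hy
      exact (Finset.prod_eq_zero (Finset.mem_univ i) (by simp [f, hi])).symm
  have h2 : ∀ i, expMeasure (w i) (s i) = ENNReal.ofReal (∫ x, f i x) := by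
    intro i
    rw [expMeasure_eq_withDensity, withDensity_apply _ (hs i),
      ofReal_integral_eq_lintegral_ofReal (hfi i) (Eventually.of_forall (hf0 i)),
      ← lintegral_indicator (hs i)]
    refine lintegral_congr fun x => ?_
    by_cases hx : x ∈ s i <;> simp [f, hx, exponentialPDF]
  simp_rw [h1, h2]
  -- Fubini for finite products is applied to real integrals; nonnegativity lets `ENNReal.ofReal`
  -- move in and out.
  rw [volume_pi, ← ofReal_integral_eq_lintegral_ofReal (Integrable.fintype_prod hfi)
    (Eventually.of_forall fun y => Finset.prod_nonneg fun i _ => hf0 i _),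
    integral_fintype_prod_eq_prod, ENNReal.ofReal_prod_of_nonneg fun i _ =>
      integral_nonneg (hf0 i)]

lemma expMeasure_Ioi_zero {r : ℝ} (hr : 0 < r) : expMeasure r (Set.Ioi 0) = 1 := by
  have := isProbabilityMeasure_expMeasure hr
  rw [prob_compl_eq_zero_iff measurableSet_Ioi |>.symm]
  rw [expMeasure_eq_withDensity, withDensity_apply _ measurableSet_Ioi.compl, Set.compl_Ioi,
    lintegral_exponentialPDF_eq_antiDeriv hr]
  simp

/-- From `1 - e^{-u} ≤ u`. Later it shows that second differences are rarely tiny. -/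
lemma expMeasure_Iic_le {r : ℝ} (hr : 0 < r) (x : ℝ) :
    expMeasure r (Set.Iic x) ≤ ENNReal.ofReal (r * x) := by
  rw [expMeasure_eq_withDensity, withDensity_apply _ measurableSet_Iic,
    lintegral_exponentialPDF_eq_antiDeriv hr]
  split_ifs with h
  · refine ENNReal.ofReal_le_ofReal ?_
    linarith [Real.add_one_le_exp (-(r * x))]
  · simp

lemma integral_expMeasure {r : ℝ} (hr : 0 < r) (f : ℝ → ℝ) :
    ∫ x, f x ∂(expMeasure r) = ∫ x in Set.Ioi 0, f x * (r * Real.exp (-(r * x))) := by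
  rw [expMeasure_eq_withDensity, integral_withDensity_eq_integral_toReal_smul
    (measurable_exponentialPDF r) (Eventually.of_forall fun x => ENNReal.ofReal_lt_top),
    ← integral_Ici_eq_integral_Ioi, ← integral_indicator measurableSet_Ici]
  refine integral_congr_ae (Eventually.of_forall fun x => ?_)
  simp only [exponentialPDF_eq, smul_eq_mul]
  by_cases hx : 0 ≤ x
  · rw [if_pos hx, ENNReal.toReal_ofReal (by positivity), Set.indicator_of_mem (by exact hx),
      mul_comm]
  · rw [if_neg hx, Set.indicator_of_notMem (by exact hx)]; simp

lemma integral_pow_expMeasure {r : ℝ} (hr : 0 < r) (k : ℕ) :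
    ∫ x, x ^ k ∂(expMeasure r) = k.factorial / r ^ k := by
  rw [integral_expMeasure hr]
  have h := Real.integral_rpow_mul_exp_neg_mul_Ioi (a := k + 1) (by positivity) hr
  rw [Real.Gamma_nat_eq_factorial] at h
  calc ∫ x in Set.Ioi 0, x ^ k * (r * Real.exp (-(r * x)))
      = r * ∫ t in Set.Ioi 0, t ^ ((k : ℝ) + 1 - 1) * Real.exp (-(r * t)) := by
        rw [← integral_const_mul]
        refine integral_congr_ae (Eventually.of_forall fun x => ?_)
        simp only [add_sub_cancel_right, Real.rpow_natCast]; ring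
    _ = k.factorial / r ^ k := by
        rw [h, show ((k : ℝ) + 1) = ((k + 1 : ℕ) : ℝ) by push_cast; ring, Real.rpow_natCast,
          one_div, inv_pow]
        field_simp
        ring

lemma integrable_pow_expMeasure {r : ℝ} (hr : 0 < r) (k : ℕ) :
    Integrable (fun x => x ^ k) (expMeasure r) := by
  -- A nonintegrable function has integral `0` by convention, but the moment formula gives a
  -- positive value.
  by_contra h
  have h1 := integral_pow_expMeasure hr k
  rw [integral_undef h] at h1
  have : (0 : ℝ) < k.factorial / r ^ k := by positivity
  linarith

lemma memLp_two_id_expMeasure {r : ℝ} (hr : 0 < r) : MemLp (fun x => x) 2 (expMeasure r) :=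
  (memLp_two_iff_integrable_sq measurable_id.aestronglyMeasurable).2
    (integrable_pow_expMeasure hr 2)

lemma variance_expMeasure {r : ℝ} (hr : 0 < r) : Var[fun x => x; expMeasure r] = 1 / r ^ 2 := by
  have := isProbabilityMeasure_expMeasure hr
  have h1 := integral_pow_expMeasure hr 1
  have h2 := integral_pow_expMeasure hr 2
  simp only [pow_one] at h1
  rw [variance_eq_sub (memLp_two_id_expMeasure hr)]
  simp only [Pi.pow_apply, h1, h2]
  norm_num [Nat.factorial]
  field_simp
  norm_num

/-- If `x` is exponentially distributed with rate `1`, then `exp (-x)` is uniform on `(0, 1)`. -/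
lemma map_exp_neg_expMeasure :
    (expMeasure 1).map (fun x => Real.exp (-x)) = (volume : Measure ℝ).restrict (Set.Ioo 0 1) := by
  have := isProbabilityMeasure_expMeasure one_pos
  have hm : Measurable fun x : ℝ => Real.exp (-x) := by fun_prop
  refine Measure.ext_of_Ici _ _ fun a => ?_
  rw [Measure.map_apply hm measurableSet_Ici, Measure.restrict_apply measurableSet_Ici]
  rcases le_or_gt a 0 with ha | ha
  · have h1 : (fun x : ℝ => Real.exp (-x)) ⁻¹' Set.Ici a = Set.univ :=
      Set.eq_univ_of_forall fun x => ha.trans (Real.exp_pos _).le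
    have h2 : Set.Ici a ∩ Set.Ioo 0 1 = Set.Ioo 0 1 :=
      Set.inter_eq_right.2 fun x hx => ha.trans hx.1.le
    rw [h1, h2]; simp
  · have h1 : (fun x : ℝ => Real.exp (-x)) ⁻¹' Set.Ici a = Set.Iic (-Real.log a) := by
      ext x
      simp only [Set.mem_preimage, Set.mem_Ici, Set.mem_Iic, ← Real.log_le_iff_le_exp ha]
      constructor <;> intro h <;> linarith
    have h2 : Set.Ici a ∩ Set.Ioo 0 1 = Set.Ico a 1 := by
      ext x; simp only [Set.mem_inter_iff, Set.mem_Ici, Set.mem_Ioo, Set.mem_Ico]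
      constructor
      · rintro ⟨h, _, h'⟩; exact ⟨h, h'⟩
      · rintro ⟨h, h'⟩; exact ⟨h, ha.trans_le h, h'⟩
    rw [h1, h2, expMeasure_eq_withDensity, withDensity_apply _ measurableSet_Iic,
      lintegral_exponentialPDF_eq_antiDeriv one_pos, Real.volume_Ico]
    split_ifs with h
    · rw [one_mul, neg_neg, Real.exp_log ha]
    · have : 1 < a := by
        by_contra h'
        exact h (by linarith [Real.log_nonpos ha.le (not_lt.1 h')])
      simp [this.le]

/-- Chebyshev's inequality for linear combinations of independent exponential variables. -/
lemma pi_expMeasure_abs_sum_sub_le {ι : Type*} [Fintype ι] {w : ι → ℝ} (hw : ∀ i, 0 < w i)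
    (c : ι → ℝ) {ε : ℝ} (hε : 0 < ε) :
    Measure.pi (fun i => expMeasure (w i)) {y | ε ≤ |∑ i, c i * y i - ∑ i, c i / w i|} ≤
      ENNReal.ofReal ((∑ i, (c i / w i) ^ 2) / ε ^ 2) := by
  have := fun i => isProbabilityMeasure_expMeasure (hw i)
  have hL : ∀ i, MemLp (fun x => c i * x) 2 (expMeasure (w i)) := fun i =>
    (memLp_two_id_expMeasure (hw i)).const_mul (c i)
  have hL' : ∀ i, MemLp (fun y : ι → ℝ => c i * y i) 2 (Measure.pi fun i => expMeasure (w i)) :=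
    fun i => (hL i).comp_measurePreserving (measurePreserving_eval _ i)
  have hsum : (∑ i, fun y : ι → ℝ => c i * y i) = fun y => ∑ i, c i * y i := by
    ext y; simp
  have hvar := variance_sum_pi hL
  rw [hsum] at hvar
  have hmean : ∫ y, ∑ i, c i * y i ∂(Measure.pi fun i => expMeasure (w i)) = ∑ i, c i / w i := by
    rw [integral_finsetSum _ fun i _ => (hL' i).integrable (by norm_num)]
    refine Finset.sum_congr rfl fun i _ => ?_
    have h0 : ∫ y : ι → ℝ, y i ∂(Measure.pi fun i => expMeasure (w i)) =
        ∫ x, x ∂(expMeasure (w i)) :=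
      integral_comp_eval (μ := fun i => expMeasure (w i)) (i := i) (f := fun x : ℝ => x)
        measurable_id.aestronglyMeasurable
    rw [integral_const_mul, h0]
    have h1 := integral_pow_expMeasure (hw i) 1
    simp only [pow_one] at h1
    rw [h1]; simp [div_eq_mul_inv]
  have hX : MemLp (fun y : ι → ℝ => ∑ i, c i * y i) 2 (Measure.pi fun i => expMeasure (w i)) :=
    memLp_finsetSum _ fun i _ => hL' i
  have h := meas_ge_le_variance_div_sq hX hε
  rw [hvar, hmean] at h
  refine h.trans_eq ?_
  congr 2
  refine Finset.sum_congr rfl fun i _ => ?_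
  rw [variance_const_mul, variance_expMeasure (hw i)]
  ring

/-! ### Second differences of a sequence, seen from a base point -/

/-- The initial slope of a sequence followed by its second differences. -/
def secondDiff (h : ℕ → ℝ) : ℕ → ℝ
  | 0 => h 1 - h 0
  | l + 1 => h (l + 2) - 2 * h (l + 1) + h l

lemma sum_secondDiff (h : ℕ → ℝ) (k : ℕ) :
    ∑ l ∈ Finset.range (k + 1), secondDiff h l = h (k + 1) - h k := by
  induction k with
  | zero => simp [secondDiff]
  | succ k ih => rw [Finset.sum_range_succ, ih, secondDiff]; ring

lemma eq_add_sum_secondDiff (h : ℕ → ℝ) (k : ℕ) :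
    h k = h 0 + ∑ l ∈ Finset.range k, ((k : ℝ) - l) * secondDiff h l := by
  induction k with
  | zero => simp
  | succ k ih =>
    have h1 : ∑ l ∈ Finset.range (k + 1), (((k + 1 : ℕ) : ℝ) - l) * secondDiff h l =
        ∑ l ∈ Finset.range k, ((k : ℝ) - l) * secondDiff h l +
          ∑ l ∈ Finset.range (k + 1), secondDiff h l := by
      rw [Finset.sum_range_succ, Finset.sum_range_succ _ k, ← add_assoc, ← Finset.sum_add_distrib]
      congr 1
      · refine Finset.sum_congr rfl fun l _ => ?_
        push_cast; ring
      · push_cast; ring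
    rw [h1, sum_secondDiff]
    linarith

/-- Summing the previous expansion over `k` gives the `l`-th coordinate the coefficient `1 + 2 + ⋯ +
(N - l)`. -/
lemma sum_eq_sum_secondDiff (h : ℕ → ℝ) (N : ℕ) :
    ∑ k ∈ Finset.range (N + 1), h k = (N + 1) * h 0 +
      ∑ l ∈ Finset.range N, ((N : ℝ) - l) * ((N : ℝ) - l + 1) / 2 * secondDiff h l := by
  induction N with
  | zero => simp
  | succ N ih =>
    have h1 : ∑ l ∈ Finset.range (N + 1),
          (((N + 1 : ℕ) : ℝ) - l) * (((N + 1 : ℕ) : ℝ) - l + 1) / 2 * secondDiff h l =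
        ∑ l ∈ Finset.range N, ((N : ℝ) - l) * ((N : ℝ) - l + 1) / 2 * secondDiff h l +
          ∑ l ∈ Finset.range (N + 1), (((N + 1 : ℕ) : ℝ) - l) * secondDiff h l := by
      rw [Finset.sum_range_succ, Finset.sum_range_succ _ N, ← add_assoc, ← Finset.sum_add_distrib]
      congr 1
      · refine Finset.sum_congr rfl fun l _ => ?_
        push_cast; ring
      · push_cast; ring
    rw [Finset.sum_range_succ, ih, h1, eq_add_sum_secondDiff h (N + 1)]
    push_cast; ring

/-- The coordinates of a sequence `g` adapted to the base point `m`: the value at `m`, and the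
second differences going away from `m` in both directions. -/
def baseCoord (m : ℕ) (g : ℕ → ℝ) (k : ℕ) : ℝ :=
  if k = m then g m
  else if m < k then secondDiff (fun j => g (m + j)) (k - m - 1)
  else secondDiff (fun j => g (m - j)) (m - k - 1)

lemma baseCoord_self (m : ℕ) (g : ℕ → ℝ) : baseCoord m g m = g m := by simp [baseCoord]

lemma baseCoord_right (m : ℕ) (g : ℕ → ℝ) (l : ℕ) :
    baseCoord m g (m + 1 + l) = secondDiff (fun j => g (m + j)) l := by
  rw [baseCoord, if_neg (by omega), if_pos (by omega), show m + 1 + l - m - 1 = l by omega]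

lemma baseCoord_left {m : ℕ} (g : ℕ → ℝ) {l : ℕ} (hl : l < m) :
    baseCoord m g (m - 1 - l) = secondDiff (fun j => g (m - j)) l := by
  rw [baseCoord, if_neg (by omega), if_neg (by omega), show m - (m - 1 - l) - 1 = l by omega]

/-- The weights expressing the sum of a sequence in terms of its base point coordinates. -/
noncomputable def baseWeight (n m k : ℕ) : ℝ :=
  if k = m then n + 1
  else if m < k then ((n : ℝ) - k + 1) * ((n : ℝ) - k + 2) / 2
  else ((k : ℝ) + 1) * ((k : ℝ) + 2) / 2

lemma baseWeight_self (n m : ℕ) : baseWeight n m m = n + 1 := by simp [baseWeight]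

lemma baseWeight_right (n m l : ℕ) : baseWeight n m (m + 1 + l) =
    ((n : ℝ) - m - l) * ((n : ℝ) - m - l + 1) / 2 := by
  rw [baseWeight, if_neg (by omega), if_pos (by omega)]; push_cast; ring

lemma baseWeight_left (n : ℕ) {m l : ℕ} (hl : l < m) : baseWeight n m (m - 1 - l) =
    ((m : ℝ) - l) * ((m : ℝ) - l + 1) / 2 := by
  rw [baseWeight, if_neg (by omega), if_neg (by omega), show m - 1 - l = m - (1 + l) by omega,
    Nat.cast_sub (by omega)]
  push_cast; ring

lemma baseWeight_pos {n k : ℕ} (hk : k ≤ n) (m : ℕ) : 0 < baseWeight n m k := by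
  have : (k : ℝ) ≤ n := by exact_mod_cast hk
  unfold baseWeight
  split_ifs
  · positivity
  · have : 0 < (n : ℝ) - k + 1 := by linarith
    have : 0 < (n : ℝ) - k + 2 := by linarith
    positivity
  · positivity

lemma sum_range_eq_sum_base {n m : ℕ} (hm : m ≤ n) (f : ℕ → ℝ) :
    ∑ k ∈ Finset.range (n + 1), f k = (∑ l ∈ Finset.range m, f (m - 1 - l)) + f m +
      ∑ l ∈ Finset.range (n - m), f (m + 1 + l) := by
  rw [Finset.sum_range_reflect, ← Finset.sum_range_succ, ← Finset.sum_range_add]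
  congr 2; omega

lemma prod_range_eq_prod_base {n m : ℕ} (hm : m ≤ n) (f : ℕ → ℝ) :
    ∏ k ∈ Finset.range (n + 1), f k = (∏ l ∈ Finset.range m, f (m - 1 - l)) * f m *
      ∏ l ∈ Finset.range (n - m), f (m + 1 + l) := by
  rw [Finset.prod_range_reflect, ← Finset.prod_range_succ, ← Finset.prod_range_add]
  congr 2; omega

/-- The one-sided identity is applied on each side of `m`; the two halves share the term `g m`,
whose total coefficient is therefore `n + 1`. This identity makes the exponential density factor in
the new coordinates. -/
lemma sum_eq_sum_baseCoord {n m : ℕ} (hm : m ≤ n) (g : ℕ → ℝ) :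
    ∑ k ∈ Finset.range (n + 1), g k =
      ∑ k ∈ Finset.range (n + 1), baseWeight n m k * baseCoord m g k := by
  have hR := sum_eq_sum_secondDiff (fun j => g (m + j)) (n - m)
  have hL := sum_eq_sum_secondDiff (fun j => g (m - j)) m
  rw [sum_range_eq_sum_base hm g, sum_range_eq_sum_base hm, baseWeight_self, baseCoord_self]
  rw [Finset.sum_range_succ'] at hR hL
  simp only [add_zero, Nat.sub_zero] at hR hL
  have h1 : ∑ l ∈ Finset.range m, g (m - 1 - l) = ∑ l ∈ Finset.range m, g (m - (l + 1)) :=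
    Finset.sum_congr rfl fun l _ => by rw [Nat.sub_sub, add_comm]
  have h2 : ∑ l ∈ Finset.range (n - m), g (m + 1 + l) =
      ∑ l ∈ Finset.range (n - m), g (m + (l + 1)) :=
    Finset.sum_congr rfl fun l _ => by rw [add_assoc, add_comm 1]
  have h3 : ∑ l ∈ Finset.range m, baseWeight n m (m - 1 - l) * baseCoord m g (m - 1 - l) =
      ∑ l ∈ Finset.range m, ((m : ℝ) - l) * ((m : ℝ) - l + 1) / 2 *
        secondDiff (fun j => g (m - j)) l :=
    Finset.sum_congr rfl fun l hl => by
      rw [baseWeight_left n (Finset.mem_range.1 hl), baseCoord_left g (Finset.mem_range.1 hl)]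
  have h4 : ∑ l ∈ Finset.range (n - m), baseWeight n m (m + 1 + l) * baseCoord m g (m + 1 + l) =
      ∑ l ∈ Finset.range (n - m), (((n - m : ℕ) : ℝ) - l) * (((n - m : ℕ) : ℝ) - l + 1) / 2 *
        secondDiff (fun j => g (m + j)) l :=
    Finset.sum_congr rfl fun l hl => by
      rw [baseWeight_right, baseCoord_right, Nat.cast_sub hm]
  rw [h1, h2, h3, h4]
  rw [Nat.cast_sub hm] at *
  linarith

lemma eq_add_sum_baseCoord (m : ℕ) (g : ℕ → ℝ) (k : ℕ) : g (m + k) =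
    baseCoord m g m + ∑ l ∈ Finset.range k, ((k : ℝ) - l) * baseCoord m g (m + 1 + l) := by
  simp_rw [baseCoord_right, baseCoord_self]
  exact eq_add_sum_secondDiff (fun j => g (m + j)) k

/-- Convexity of the finite sequence `g 0, …, g n`. -/
def ConvexSeq (n : ℕ) (g : ℕ → ℝ) : Prop := ∀ k, k + 2 ≤ n → 2 * g (k + 1) ≤ g k + g (k + 2)

/-- Take `m` to be a minimiser: the outward slopes at `m` are nonnegative by minimality, the second
differences by convexity. -/
lemma ConvexSeq.exists_baseCoord_nonneg {n : ℕ} {g : ℕ → ℝ} (hg : ConvexSeq n g)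
    (h0 : ∀ k ≤ n, 0 ≤ g k) : ∃ m ≤ n, ∀ k ≤ n, 0 ≤ baseCoord m g k := by
  obtain ⟨m, hm, hmin⟩ := Finset.exists_min_image (Finset.range (n + 1)) g ⟨0, by simp⟩
  simp only [Finset.mem_range, Nat.lt_succ_iff] at hm hmin
  refine ⟨m, hm, fun k hk => ?_⟩
  rcases lt_trichotomy m k with h | rfl | h
  · obtain ⟨l, rfl⟩ := Nat.exists_eq_add_of_le (Nat.succ_le_of_lt h)
    rw [Nat.succ_eq_add_one, baseCoord_right]
    rcases l with _ | l
    · simpa [secondDiff] using hmin _ hk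
    · have := hg (m + l) (by omega)
      simp only [secondDiff, ← add_assoc]; linarith
  · rw [baseCoord_self]; exact h0 _ hm
  · obtain ⟨l, hl, rfl⟩ : ∃ l, l < m ∧ k = m - 1 - l := ⟨m - 1 - k, by omega, by omega⟩
    rw [baseCoord_left g hl]
    rcases l with _ | l
    · simpa [secondDiff] using hmin _ hk
    · have := hg (m - (l + 2)) (by omega)
      rw [show m - (l + 2) + 1 = m - (l + 1) by omega,
        show m - (l + 2) + 2 = m - l by omega] at this
      simp only [secondDiff]; linarith

lemma convexSeq_of_baseCoord_nonneg {n m : ℕ} {g : ℕ → ℝ}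
    (h : ∀ k ≤ n, 0 ≤ baseCoord m g k) : ConvexSeq n g := by
  intro k hk
  rcases lt_trichotomy m (k + 1) with h' | h' | h'
  · obtain ⟨l, rfl⟩ := Nat.exists_eq_add_of_le (Nat.le_of_lt_succ h')
    have := h (m + 1 + (l + 1)) (by omega)
    rw [baseCoord_right] at this
    simp only [secondDiff, ← add_assoc] at this; linarith
  -- At the base point no second difference is a coordinate; convexity there is the sum of the two
  -- outward slopes.
  · have h1 := h (m + 1 + 0) (by omega)
    have h2 := h (m - 1 - 0) (by omega)
    rw [baseCoord_right] at h1
    rw [baseCoord_left g (by omega)] at h2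
    simp only [secondDiff, add_zero, Nat.sub_zero] at h1 h2
    rw [show k + 2 = m + 1 by omega, show k + 1 = m by omega, show k = m - 1 by omega]
    linarith
  · have := h k (by omega)
    obtain ⟨l, hl⟩ : ∃ l, m = k + 2 + l := ⟨m - (k + 2), by omega⟩
    rw [show k = m - 1 - (l + 1) by omega, baseCoord_left g (by omega)] at this
    simp only [secondDiff] at this
    rw [show m - (l + 2) = k by omega, show m - (l + 1) = k + 1 by omega,
      show m - l = k + 2 by omega] at this
    linarith

/-- With positive coordinates the sequence increases strictly away from its base point, so `m < m'`
would give both `g m < g m'` and `g m' < g m`. Applied both ways, this makes the positive cells of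
different base points disjoint. -/
lemma le_of_baseCoord_pos {n m m' : ℕ} (hm' : m' ≤ n) {g : ℕ → ℝ}
    (h : ∀ k ≤ n, 0 < baseCoord m g k) (h' : ∀ k ≤ n, 0 < baseCoord m' g k) : m' ≤ m := by
  by_contra hlt
  obtain ⟨l, rfl⟩ := Nat.exists_eq_add_of_lt (not_le.1 hlt)
  have h1 := eq_add_sum_secondDiff (fun j => g (m + j)) (l + 1)
  have h2 := eq_add_sum_secondDiff (fun j => g (m + l + 1 - j)) (l + 1)
  have p1 : 0 < ∑ i ∈ Finset.range (l + 1),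
      (((l + 1 : ℕ) : ℝ) - i) * secondDiff (fun j => g (m + j)) i := by
    refine Finset.sum_pos (fun i hi => ?_) ⟨0, by simp⟩
    have hi' : i < l + 1 := Finset.mem_range.1 hi
    have : (i : ℝ) < (l + 1 : ℕ) := by exact_mod_cast hi'
    rw [← baseCoord_right]
    exact mul_pos (by linarith) (h _ (by omega))
  have p2 : 0 < ∑ i ∈ Finset.range (l + 1),
      (((l + 1 : ℕ) : ℝ) - i) * secondDiff (fun j => g (m + l + 1 - j)) i := by
    refine Finset.sum_pos (fun i hi => ?_) ⟨0, by simp⟩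
    have hi' : i < l + 1 := Finset.mem_range.1 hi
    have : (i : ℝ) < (l + 1 : ℕ) := by exact_mod_cast hi'
    rw [← baseCoord_left g (by omega)]
    exact mul_pos (by linarith) (h' _ (by omega))
  simp only [add_zero, Nat.sub_zero] at h1 h2
  rw [show m + l + 1 - (l + 1) = m by omega] at h2
  rw [← add_assoc] at h1
  linarith

/-! ### The base point coordinates as a volume preserving linear map -/

/-- A finite sequence, extended by zero. -/
def extend {n : ℕ} (x : Fin (n + 1) → ℝ) (k : ℕ) : ℝ := if h : k < n + 1 then x ⟨k, h⟩ else 0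

lemma extend_coe {n : ℕ} (x : Fin (n + 1) → ℝ) (i : Fin (n + 1)) : extend x i = x i := by
  rw [extend, dif_pos i.2]

/-- The base point coordinates of a finite sequence, as a linear map. -/
def baseMap (n m : ℕ) : (Fin (n + 1) → ℝ) →ₗ[ℝ] (Fin (n + 1) → ℝ) where
  toFun x i := baseCoord m (extend x) i
  map_add' x y := by
    have : extend (x + y) = extend x + extend y := by
      ext k; by_cases h : k < n + 1 <;> simp [extend, h]
    ext i
    simp only [this, baseCoord, Pi.add_apply]
    split_ifs
    · rfl
    · rcases (i : ℕ) - m - 1 with _ | l <;> simp only [secondDiff] <;> ring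
    · rcases m - (i : ℕ) - 1 with _ | l <;> simp only [secondDiff] <;> ring
  map_smul' c x := by
    have : extend (c • x) = c • extend x := by
      ext k; by_cases h : k < n + 1 <;> simp [extend, h]
    ext i
    simp only [this, baseCoord, Pi.smul_apply, smul_eq_mul, RingHom.id_apply]
    split_ifs
    · rfl
    · rcases (i : ℕ) - m - 1 with _ | l <;> simp only [secondDiff] <;> ring
    · rcases m - (i : ℕ) - 1 with _ | l <;> simp only [secondDiff] <;> ring

lemma baseMap_apply (n m : ℕ) (x : Fin (n + 1) → ℝ) (i : Fin (n + 1)) :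
    baseMap n m x i = baseCoord m (extend x) i := rfl

lemma secondDiff_ite (p : ℕ → Prop) [DecidablePred p] (l : ℕ) (hp : ∀ j ≤ l, ¬ p j) :
    secondDiff (fun j => if p j then (1 : ℝ) else 0) l = if p (l + 1) then 1 else 0 := by
  rcases l with _ | l
  · simp [secondDiff, hp 0 le_rfl]
  · simp [secondDiff, hp l (by omega), hp (l + 1) le_rfl]

/-- The truncated differences add up to the distance from `m`. Coordinate `i` involves only `g i`,
with coefficient 1, and values strictly closer to `m`. -/
lemma baseCoord_single {m i j : ℕ} (h : (i - m) + (m - i) ≤ (j - m) + (m - j)) :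
    baseCoord m (fun k => if k = j then (1 : ℝ) else 0) i = if i = j then 1 else 0 := by
  unfold baseCoord
  by_cases h1 : i = m
  · rw [if_pos h1, h1]
  rw [if_neg h1]
  by_cases h2 : m < i
  · rw [if_pos h2, secondDiff_ite (fun k => m + k = j) _ (by intros; omega)]
    exact if_congr (by omega) rfl rfl
  · rw [if_neg h2, secondDiff_ite (fun k => m - k = j) _ (by intros; omega)]
    exact if_congr (by omega) rfl rfl

/-- Grading the indices by distance from `m` makes the matrix block triangular; each diagonal block,
coming from at most the two indices `m ± d`, is an identity. -/
lemma det_baseMap (n m : ℕ) : LinearMap.det (baseMap n m) = 1 := by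
  rw [← LinearMap.det_toMatrix', ← Matrix.det_transpose]
  set b : Fin (n + 1) → ℕ := fun i => ((i : ℕ) - m) + (m - (i : ℕ))
  have hentry : ∀ i j, b i ≤ b j →
      LinearMap.toMatrix' (baseMap n m) i j = if i = j then 1 else 0 := by
    intro i j hij
    rw [LinearMap.toMatrix'_apply, baseMap_apply]
    have : extend (fun j' => if j' = j then (1 : ℝ) else 0) =
        fun k => if k = (j : ℕ) then 1 else 0 := by
      ext k
      by_cases h : k < n + 1
      · simp [extend, h, Fin.ext_iff]
      · have : k ≠ j := by omega
        simp [extend, h, this]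
    have h2 : (Pi.single j (1 : ℝ) : Fin (n + 1) → ℝ) =
        fun j' => if j' = j then (1 : ℝ) else 0 := by
      ext k; simp [Pi.single_apply]
    rw [h2, this, baseCoord_single hij]
    simp [Fin.ext_iff]
  have hbt : Matrix.BlockTriangular (LinearMap.toMatrix' (baseMap n m)).transpose b := by
    intro i j hij
    rw [Matrix.transpose_apply, hentry j i hij.le, if_neg]
    rintro rfl; exact lt_irrefl _ hij
  rw [hbt.det]
  refine Finset.prod_eq_one fun a _ => ?_
  have h1 : (LinearMap.toMatrix' (baseMap n m)).transpose.toSquareBlock b a = 1 := by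
    ext i j
    rw [Matrix.toSquareBlock_def, Matrix.of_apply, Matrix.transpose_apply,
      hentry _ _ (j.2.trans i.2.symm).le, Matrix.one_apply]
    simp [Subtype.ext_iff, eq_comm]
  rw [h1, Matrix.det_one]

/-! ### Convex sequences of exponential variables as a mixture over the base point -/

/-- The law of `n + 1` independent exponential variables of rate `1`. -/
noncomputable def iidExp (n : ℕ) : Measure (Fin (n + 1) → ℝ) :=
  Measure.pi fun _ => expMeasure 1

/-- The law of independent exponential variables whose rates are the base point weights. -/
noncomputable def baseLaw (n m : ℕ) : Measure (Fin (n + 1) → ℝ) :=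
  Measure.pi fun i => expMeasure (baseWeight n m i)

/-- The mass of the component of base point `m`. -/
noncomputable def baseMass (n m : ℕ) : ℝ := ∏ i : Fin (n + 1), (baseWeight n m i)⁻¹

lemma baseWeight_coe_pos {n : ℕ} (m : ℕ) (i : Fin (n + 1)) : 0 < baseWeight n m i :=
  baseWeight_pos (Nat.lt_succ_iff.1 i.2) m

lemma baseMass_pos (n m : ℕ) : 0 < baseMass n m :=
  Finset.prod_pos fun i _ => inv_pos.2 (baseWeight_coe_pos m i)

instance (n m : ℕ) : IsProbabilityMeasure (baseLaw n m) := by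
  have := fun i : Fin (n + 1) => isProbabilityMeasure_expMeasure (baseWeight_coe_pos m i)
  unfold baseLaw; infer_instance

instance (n : ℕ) : IsProbabilityMeasure (iidExp n) := by
  have := isProbabilityMeasure_expMeasure one_pos
  unfold iidExp; infer_instance

lemma ae_pi_expMeasure_pos {ι : Type*} [Fintype ι] {w : ι → ℝ} (hw : ∀ i, 0 < w i) :
    ∀ᵐ y ∂(Measure.pi fun i => expMeasure (w i)), ∀ i, 0 < y i := by
  have := fun i => isProbabilityMeasure_expMeasure (hw i)
  refine ae_all_iff.2 fun i => ?_
  have h : ∀ᵐ x ∂(expMeasure (w i)), 0 < x :=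
    (prob_compl_eq_zero_iff measurableSet_Ioi).2 (expMeasure_Ioi_zero (hw i))
  exact (measurePreserving_eval (fun i => expMeasure (w i)) i).quasiMeasurePreserving.ae h

/-- The sequence is nondecreasing away from `m`, starting from a nonnegative value. So the cone of
nonnegative coordinates lies in the orthant where the exponential density is not cut off. -/
lemma nonneg_of_baseCoord_nonneg {n m : ℕ} (hm : m ≤ n) {g : ℕ → ℝ}
    (h : ∀ k ≤ n, 0 ≤ baseCoord m g k) {k : ℕ} (hk : k ≤ n) : 0 ≤ g k := by
  have h0 : 0 ≤ g m := by simpa [baseCoord_self] using h m hm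
  rcases le_total m k with hmk | hmk
  · obtain ⟨l, rfl⟩ := Nat.exists_eq_add_of_le hmk
    rw [eq_add_sum_secondDiff (fun j => g (m + j)) l]
    refine add_nonneg h0 (Finset.sum_nonneg fun i hi => ?_)
    have hi' := Finset.mem_range.1 hi
    have : (i : ℝ) < l := by exact_mod_cast hi'
    rw [← baseCoord_right]
    exact mul_nonneg (by linarith) (h _ (by omega))
  · have h1 := eq_add_sum_secondDiff (fun j => g (m - j)) (m - k)
    simp only [Nat.sub_sub_self hmk, Nat.sub_zero] at h1
    rw [h1]
    refine add_nonneg h0 (Finset.sum_nonneg fun i hi => ?_)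
    have hi' := Finset.mem_range.1 hi
    have : (i : ℝ) < (m - k : ℕ) := by exact_mod_cast hi'
    rw [← baseCoord_left g (by omega)]
    exact mul_nonneg (by linarith) (h _ (by omega))

lemma sum_eq_sum_baseMap {n m : ℕ} (hm : m ≤ n) (x : Fin (n + 1) → ℝ) :
    ∑ i, x i = ∑ i : Fin (n + 1), baseWeight n m i * baseMap n m x i := by
  have h := sum_eq_sum_baseCoord hm (extend x)
  rw [← Fin.sum_univ_eq_sum_range, ← Fin.sum_univ_eq_sum_range
    (fun k => baseWeight n m k * baseCoord m (extend x) k)] at h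
  simpa only [extend_coe, baseMap_apply] using h

lemma measurable_baseMap (n m : ℕ) : Measurable (baseMap n m) :=
  (baseMap n m).continuous_of_finiteDimensional.measurable

lemma map_baseMap_volume (n m : ℕ) :
    (volume : Measure (Fin (n + 1) → ℝ)).map (baseMap n m) = volume := by
  rw [Measure.map_linearMap_addHaar_eq_smul_addHaar _ (by rw [det_baseMap]; exact one_ne_zero),
    det_baseMap]
  simp

/-- On the region with nonnegative base point coordinates, these coordinates are independent
exponential variables, up to the total mass. -/
lemma iidExp_baseMap {n m : ℕ} (hm : m ≤ n) {B : Set (Fin (n + 1) → ℝ)} (hB : MeasurableSet B) :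
    iidExp n {x | (∀ i, 0 ≤ baseMap n m x i) ∧ baseMap n m x ∈ B} =
      ENNReal.ofReal (baseMass n m) * baseLaw n m B := by
  set C : Set (Fin (n + 1) → ℝ) := {y | ∀ i, 0 ≤ y i} ∩ B
  have hC : MeasurableSet C := by
    refine MeasurableSet.inter ?_ hB
    simp only [Set.ofPred_forall]
    exact MeasurableSet.iInter fun i => measurableSet_le measurable_const (measurable_pi_apply i)
  set φ : (Fin (n + 1) → ℝ) → ENNReal := fun y =>
    ENNReal.ofReal (Real.exp (-∑ i : Fin (n + 1), baseWeight n m i * y i))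
  have hφ : Measurable φ := by fun_prop
  -- The factor `baseMass` cancels the normalising constants of the exponential densities.
  have hR : ENNReal.ofReal (baseMass n m) * baseLaw n m B = ∫⁻ y in C, φ y := by
    rw [baseLaw, pi_expMeasure (baseWeight_coe_pos m), withDensity_apply _ hB,
      ← lintegral_const_mul' _ _ ENNReal.ofReal_ne_top, ← lintegral_indicator hB,
      ← lintegral_indicator hC]
    refine lintegral_congr fun y => ?_
    by_cases hyB : y ∈ B
    · rw [Set.indicator_of_mem hyB]
      by_cases hy : ∀ i, 0 ≤ y i
      · rw [Set.indicator_of_mem (show y ∈ C from ⟨hy, hyB⟩)]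
        simp_rw [exponentialPDF_of_nonneg (hy _)]
        rw [← ENNReal.ofReal_prod_of_nonneg fun i _ =>
          mul_nonneg (baseWeight_coe_pos m i).le (Real.exp_pos _).le,
          ← ENNReal.ofReal_mul (baseMass_pos n m).le, baseMass, ← Finset.prod_mul_distrib]
        simp only [φ]
        rw [← Finset.sum_neg_distrib, Real.exp_sum]
        congr 1
        refine Finset.prod_congr rfl fun i _ => ?_
        have := (baseWeight_coe_pos m i).ne'
        field_simp
      · rw [Set.indicator_of_notMem fun h => hy h.1]
        push Not at hy
        obtain ⟨i, hi⟩ := hy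
        rw [Finset.prod_eq_zero (Finset.mem_univ i) (exponentialPDF_of_neg hi), mul_zero]
    · rw [Set.indicator_of_notMem hyB, Set.indicator_of_notMem fun h => hyB h.2]
  have hA : {x | (∀ i, 0 ≤ baseMap n m x i) ∧ baseMap n m x ∈ B} = baseMap n m ⁻¹' C := rfl
  have hAm := measurable_baseMap n m hC
  -- Volume-preserving change of variables: the density `exp (-∑ x i)` is `φ` evaluated at the new
  -- coordinates.
  rw [hR, hA, iidExp, pi_expMeasure fun _ => one_pos, withDensity_apply _ hAm,
    ← map_baseMap_volume n m, setLIntegral_map hC hφ (measurable_baseMap n m), map_baseMap_volume]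
  refine setLIntegral_congr_fun hAm fun x hx => ?_
  have hx0 : ∀ i, 0 ≤ x i := by
    intro i
    have := nonneg_of_baseCoord_nonneg hm (g := extend x)
      (fun k hk => hx.1 ⟨k, Nat.lt_succ_of_le hk⟩) (Nat.lt_succ_iff.1 i.2)
    rwa [extend_coe] at this
  simp only [φ]
  simp_rw [exponentialPDF_of_nonneg (hx0 _)]
  rw [← ENNReal.ofReal_prod_of_nonneg fun i _ => by positivity, ← sum_eq_sum_baseMap hm,
    ← Finset.sum_neg_distrib, Real.exp_sum]
  simp

/-- The set of convex sequences. -/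
def convexSet (n : ℕ) : Set (Fin (n + 1) → ℝ) := {x | ConvexSeq n (extend x)}

/-- A union bound over base points; it bounds the numerator of the conditional probability, and
overlapping cells do no harm. -/
lemma iidExp_convexSet_inter_le {n : ℕ} (E : Set (Fin (n + 1) → ℝ))
    (B : ℕ → Set (Fin (n + 1) → ℝ)) (hB : ∀ m, MeasurableSet (B m))
    (h : ∀ m ≤ n, ∀ x ∈ E, (∀ i, 0 ≤ baseMap n m x i) → baseMap n m x ∈ B m) :
    iidExp n (convexSet n ∩ E) ≤
      ∑ m ∈ Finset.range (n + 1), ENNReal.ofReal (baseMass n m) * baseLaw n m (B m) := by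
  have h0 : iidExp n {x | ¬ ∀ i, 0 < x i} = 0 := ae_pi_expMeasure_pos fun _ => one_pos
  have hsub : convexSet n ∩ E ⊆ {x | ¬ ∀ i, 0 < x i} ∪ ⋃ m ∈ Finset.range (n + 1),
      {x | (∀ i, 0 ≤ baseMap n m x i) ∧ baseMap n m x ∈ B m} := by
    rintro x ⟨hxK, hxE⟩
    by_cases hx : ∀ i, 0 < x i
    · right
      obtain ⟨m, hm, hm'⟩ := hxK.exists_baseCoord_nonneg fun k hk => by
        rw [extend, dif_pos (Nat.lt_succ_of_le hk)]; exact (hx _).le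
      have hx' : ∀ i, 0 ≤ baseMap n m x i := fun i => hm' i (Nat.lt_succ_iff.1 i.2)
      simp only [Set.mem_iUnion]
      exact ⟨m, by simpa [Nat.lt_succ_iff] using hm, hx', h m hm x hxE hx'⟩
    · left; exact hx
  refine (measure_mono hsub).trans ((measure_union_le _ _).trans ?_)
  rw [h0, zero_add]
  refine (measure_biUnion_finset_le _ _).trans (Finset.sum_le_sum fun m hm => ?_)
  rw [iidExp_baseMap (Nat.lt_succ_iff.1 (Finset.mem_range.1 hm)) (hB m)]

lemma measurableSet_forall_pos (n : ℕ) : MeasurableSet {y : Fin (n + 1) → ℝ | ∀ i, 0 < y i} := by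
  simp only [Set.ofPred_forall]
  exact MeasurableSet.iInter fun i => measurableSet_lt measurable_const (measurable_pi_apply i)

/-- The cells with positive coordinates are disjoint and consist of convex sequences. This is the
matching bound for the denominator. -/
lemma sum_baseMass_le (n : ℕ) :
    ∑ m ∈ Finset.range (n + 1), ENNReal.ofReal (baseMass n m) ≤ iidExp n (convexSet n) := by
  set U : ℕ → Set (Fin (n + 1) → ℝ) := fun m => {x | ∀ i, 0 < baseMap n m x i}
  have hU : ∀ m ∈ Finset.range (n + 1), iidExp n (U m) = ENNReal.ofReal (baseMass n m) := by
    intro m hm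
    have h1 := iidExp_baseMap (Nat.lt_succ_iff.1 (Finset.mem_range.1 hm))
      (measurableSet_forall_pos n)
    have h2 : baseLaw n m {y | ∀ i, 0 < y i} = 1 :=
      (prob_compl_eq_zero_iff (measurableSet_forall_pos n)).1
        (ae_pi_expMeasure_pos (baseWeight_coe_pos m))
    rw [h2, mul_one] at h1
    rw [← h1]
    congr 1
    ext x
    exact ⟨fun hx => ⟨fun i => (hx i).le, hx⟩, fun hx => hx.2⟩
  have hco : ∀ (m : ℕ) (x : Fin (n + 1) → ℝ), x ∈ U m → ∀ k ≤ n, 0 < baseCoord m (extend x) k :=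
    fun m x hx k hk => hx ⟨k, Nat.lt_succ_of_le hk⟩
  rw [← Finset.sum_congr rfl hU, ← measure_biUnion_finset]
  · refine measure_mono fun x hx => ?_
    simp only [Set.mem_iUnion] at hx
    obtain ⟨m, _, hx⟩ := hx
    exact convexSeq_of_baseCoord_nonneg fun k hk => (hco m x hx k hk).le
  · intro m hm m' hm' hne
    refine Set.disjoint_left.2 fun x hx hx' => hne ?_
    simp only [Finset.coe_range, Set.mem_Iio, Nat.lt_succ_iff] at hm hm'
    exact le_antisymm (le_of_baseCoord_pos hm (hco _ x hx') (hco _ x hx))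
      (le_of_baseCoord_pos hm' (hco _ x hx) (hco _ x hx'))
  · intro m _
    exact measurable_baseMap n m (measurableSet_forall_pos n)

/-! ### Concentration of the base point -/

/-- `∏_{l < N} (N - l) (N - l + 1) / 2`. -/
noncomputable def triangularFactorial (N : ℕ) : ℝ :=
  ∏ l ∈ Finset.range N, ((N : ℝ) - l) * ((N : ℝ) - l + 1) / 2

lemma triangularFactorial_succ (N : ℕ) : triangularFactorial (N + 1) =
    triangularFactorial N * (((N : ℝ) + 1) * (N + 2) / 2) := by
  rw [triangularFactorial, Finset.prod_range_succ', triangularFactorial]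
  congr 1
  · refine Finset.prod_congr rfl fun l _ => ?_
    push_cast; ring
  · push_cast; ring

lemma baseMass_inv_eq {n m : ℕ} (hm : m ≤ n) : (baseMass n m)⁻¹ =
    triangularFactorial m * (n + 1) * triangularFactorial (n - m) := by
  rw [baseMass, Finset.prod_inv_distrib, inv_inv, Fin.prod_univ_eq_prod_range,
    prod_range_eq_prod_base hm, baseWeight_self]
  congr 1
  · congr 1
    exact Finset.prod_congr rfl fun l hl => baseWeight_left n (Finset.mem_range.1 hl)
  · refine Finset.prod_congr rfl fun l hl => ?_
    rw [baseWeight_right, Nat.cast_sub hm]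

/-- Moving the base point one step adds a triangular factor on one side and removes one on the
other. -/
lemma baseMass_succ {n m : ℕ} (hm : m < n) :
    baseMass n m * (((n : ℝ) - m) * (n - m + 1)) =
      baseMass n (m + 1) * (((m : ℝ) + 1) * (m + 2)) := by
  have h1 := baseMass_inv_eq hm.le
  have h2 := baseMass_inv_eq (Nat.succ_le_of_lt hm)
  obtain ⟨k, rfl⟩ := Nat.exists_eq_add_of_lt hm
  rw [show m + k + 1 - m = k + 1 by omega, triangularFactorial_succ] at h1
  rw [Nat.succ_eq_add_one, show m + k + 1 - (m + 1) = k by omega, triangularFactorial_succ] at h2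
  have p1 := baseMass_pos (m + k + 1) m
  have p2 := baseMass_pos (m + k + 1) (m + 1)
  rw [← inv_inj, mul_inv (baseMass _ m), mul_inv (baseMass _ (m + 1)), h1, h2]
  push_cast
  have : ((m : ℝ) + k + 1 - m) = k + 1 := by ring
  rw [this]
  field_simp
  ring

/-- With `R m` and `T m` as below, `R m - T m = baseMass n m * (n + 1) * (n - 2 m)`, while
`baseMass_succ` says `R m = T (m + 1)`. Multiplying by `n - 2 m` and summing by parts leaves `2 ∑
T`, and `T m ≤ n (n + 1) * baseMass n m`. -/
lemma sum_baseMass_mul_sq_le (n : ℕ) :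
    ∑ m ∈ Finset.range (n + 1), baseMass n m * ((n : ℝ) - 2 * m) ^ 2 ≤
      2 * n * ∑ m ∈ Finset.range (n + 1), baseMass n m := by
  set T : ℕ → ℝ := fun m => baseMass n m * ((m : ℝ) * (m + 1))
  set R : ℕ → ℝ := fun m => baseMass n m * (((n : ℝ) - m) * (n - m + 1))
  have hR : ∑ m ∈ Finset.range (n + 1), R m * ((n : ℝ) - 2 * m) =
      ∑ m ∈ Finset.range n, T (m + 1) * ((n : ℝ) - 2 * m) := by
    rw [Finset.sum_range_succ]
    have : R n = 0 := by simp [R]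
    rw [this, zero_mul, add_zero]
    refine Finset.sum_congr rfl fun m hm => ?_
    simp only [R, T]
    rw [baseMass_succ (Finset.mem_range.1 hm)]
    push_cast; ring
  have hT : ∑ m ∈ Finset.range (n + 1), T m * ((n : ℝ) - 2 * m) =
      ∑ m ∈ Finset.range n, T (m + 1) * ((n : ℝ) - 2 * m - 2) := by
    rw [Finset.sum_range_succ']
    have : T 0 = 0 := by simp [T]
    rw [this, zero_mul, add_zero]
    refine Finset.sum_congr rfl fun m _ => ?_
    push_cast; ring
  have hT' : ∑ m ∈ Finset.range n, T (m + 1) ≤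
      n * (n + 1) * ∑ m ∈ Finset.range (n + 1), baseMass n m := by
    have : ∑ m ∈ Finset.range n, T (m + 1) = ∑ m ∈ Finset.range (n + 1), T m := by
      rw [Finset.sum_range_succ']; simp [T]
    rw [this, Finset.mul_sum]
    refine Finset.sum_le_sum fun m hm => ?_
    have hm' : (m : ℝ) ≤ n := by exact_mod_cast Nat.lt_succ_iff.1 (Finset.mem_range.1 hm)
    have h1 : (m : ℝ) * (m + 1) ≤ n * (n + 1) := by gcongr
    rw [mul_comm ((n : ℝ) * (n + 1))]
    exact mul_le_mul_of_nonneg_left h1 (baseMass_pos n m).le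
  have hkey : ((n : ℝ) + 1) * ∑ m ∈ Finset.range (n + 1), baseMass n m * ((n : ℝ) - 2 * m) ^ 2 =
      2 * ∑ m ∈ Finset.range n, T (m + 1) := by
    calc _ = ∑ m ∈ Finset.range (n + 1), R m * ((n : ℝ) - 2 * m) -
          ∑ m ∈ Finset.range (n + 1), T m * ((n : ℝ) - 2 * m) := by
          rw [Finset.mul_sum, ← Finset.sum_sub_distrib]
          refine Finset.sum_congr rfl fun m _ => ?_
          simp only [R, T]; ring
      _ = _ := by
          rw [hR, hT, ← Finset.sum_sub_distrib, Finset.mul_sum]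
          refine Finset.sum_congr rfl fun m _ => ?_
          ring
  have hn : (0 : ℝ) < n + 1 := by positivity
  refine le_of_mul_le_mul_left ?_ hn
  rw [hkey]
  calc _ ≤ 2 * (n * (n + 1) * ∑ m ∈ Finset.range (n + 1), baseMass n m) := by gcongr
    _ = _ := by ring

/-! ### From the uniform model to exponential variables -/

/-- The map taking exponential variables to uniform ones. -/
noncomputable def negExp {n : ℕ} (x : Fin (n + 1) → ℝ) : Fin (n + 1) → ℝ := fun i => Real.exp (-x i)

lemma measurable_negExp {n : ℕ} : Measurable (negExp (n := n)) := by
  unfold negExp; fun_prop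

lemma iidUniform_eq_map (n : ℕ) : iidUniform n = (iidExp n).map negExp := by
  have h1 : IsProbabilityMeasure ((expMeasure 1).map fun x => Real.exp (-x)) := by
    have := isProbabilityMeasure_expMeasure one_pos
    exact Measure.isProbabilityMeasure_map (by fun_prop)
  rw [iidUniform, iidExp, ← map_exp_neg_expMeasure]
  exact (Measure.pi_map_pi (f := fun (_ : Fin (n + 1)) (x : ℝ) => Real.exp (-x))
    fun _ => by fun_prop).symm

lemma measurableSet_logConcaveSet (n : ℕ) : MeasurableSet (logConcaveSet n) := by
  have : logConcaveSet n = ⋂ (i : Fin (n + 1)) (j : Fin (n + 1)) (k : Fin (n + 1))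
      (_ : (i : ℕ) + 1 = j) (_ : (j : ℕ) + 1 = k), {u | u i * u k ≤ u j ^ 2} := by
    ext u; simp [logConcaveSet]
  rw [this]
  refine MeasurableSet.iInter fun i => MeasurableSet.iInter fun j => MeasurableSet.iInter fun k =>
    MeasurableSet.iInter fun _ => MeasurableSet.iInter fun _ => ?_
  exact measurableSet_le (by fun_prop) (by fun_prop)

lemma extend_of_le {n : ℕ} (x : Fin (n + 1) → ℝ) {k : ℕ} (hk : k ≤ n) :
    extend x k = x ⟨k, Nat.lt_succ_of_le hk⟩ := dif_pos _

lemma negExp_preimage_logConcaveSet (n : ℕ) : negExp ⁻¹' logConcaveSet n = convexSet n := by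
  ext x
  have key : ∀ a b c : ℝ, Real.exp (-a) * Real.exp (-c) ≤ Real.exp (-b) ^ 2 ↔ 2 * b ≤ a + c := by
    intro a b c
    rw [← Real.exp_add, ← Real.exp_nat_mul, Real.exp_le_exp]
    push_cast
    constructor <;> intro h <;> linarith
  constructor
  · intro h k hk
    have := h ⟨k, by omega⟩ ⟨k + 1, by omega⟩ ⟨k + 2, by omega⟩ rfl rfl
    rw [extend_of_le x (by omega), extend_of_le x (by omega), extend_of_le x hk]
    exact (key _ _ _).1 this
  · intro h i j k hij hjk
    have := h i (by omega)
    rw [hij, show (i : ℕ) + 2 = k by omega, extend_coe, extend_coe, extend_coe] at this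
    exact (key _ _ _).2 this

lemma uniformModel_apply {n : ℕ} {A : Set (Fin (n + 1) → ℝ)} (hA : MeasurableSet A) :
    uniformModel n A = (iidExp n (convexSet n))⁻¹ * iidExp n (convexSet n ∩ negExp ⁻¹' A) := by
  have hK := measurableSet_logConcaveSet n
  rw [uniformModel, cond_apply hK, iidUniform_eq_map, Measure.map_apply measurable_negExp hK,
    Measure.map_apply measurable_negExp (hK.inter hA), Set.preimage_inter,
    negExp_preimage_logConcaveSet]

/-- The filter of pairs `(n, m)` with `n → ∞` and `m / n → 1 / 2`. -/
noncomputable def centralFilter : Filter (ℕ × ℕ) :=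
  comap Prod.fst atTop ⊓ comap (fun p : ℕ × ℕ => (p.2 : ℝ) / p.1) (𝓝 (1 / 2))

lemma tendsto_fst_centralFilter : Tendsto Prod.fst centralFilter atTop :=
  tendsto_comap.mono_left inf_le_left

lemma tendsto_div_centralFilter :
    Tendsto (fun p : ℕ × ℕ => (p.2 : ℝ) / p.1) centralFilter (𝓝 (1 / 2)) :=
  tendsto_comap.mono_left inf_le_right

lemma exists_of_eventually_centralFilter {q : ℕ × ℕ → Prop} (h : ∀ᶠ p in centralFilter, q p) :
    ∃ (N : ℕ) (δ : ℝ), 0 < δ ∧ ∀ n m : ℕ, N ≤ n → |(m : ℝ) / n - 1 / 2| < δ → q (n, m) := by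
  have hb := (atTop_basis.comap (Prod.fst : ℕ × ℕ → ℕ)).inf
    ((Metric.nhds_basis_ball (x := (1 / 2 : ℝ))).comap (fun p : ℕ × ℕ => (p.2 : ℝ) / p.1))
  obtain ⟨⟨N, δ⟩, ⟨_, hδ⟩, hsub⟩ := hb.eventually_iff.1 h
  refine ⟨N, δ, hδ, fun n m hn hm => @hsub (n, m) ⟨hn, ?_⟩⟩
  simpa [Real.dist_eq] using hm

/-- Events of the uniform model that are unlikely uniformly over all base points close to the
middle are unlikely. -/
theorem tendsto_uniformModel_zero (A : ∀ n : ℕ, Set (Fin (n + 1) → ℝ))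
    (hA : ∀ n, MeasurableSet (A n)) (B : ∀ n : ℕ, ℕ → Set (Fin (n + 1) → ℝ))
    (hBm : ∀ n m, MeasurableSet (B n m))
    (h : ∀ᶠ p in centralFilter, ∀ x : Fin (p.1 + 1) → ℝ, (∀ i, 0 ≤ baseMap p.1 p.2 x i) →
      negExp x ∈ A p.1 → baseMap p.1 p.2 x ∈ B p.1 p.2)
    (hB : Tendsto (fun p : ℕ × ℕ => baseLaw p.1 p.2 (B p.1 p.2)) centralFilter (𝓝 0)) :
    Tendsto (fun n => uniformModel n (A n)) atTop (𝓝 0) := by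
  classical
  rw [ENNReal.tendsto_nhds_zero] at hB ⊢
  intro ε' hε'
  obtain ⟨ε, hε0, hε1⟩ := ENNReal.lt_iff_exists_nnreal_btwn.1 hε'
  have hε : (0 : ℝ) < ε := by exact_mod_cast hε0
  have hε2 : (0 : ENNReal) < ENNReal.ofReal (ε / 2) := ENNReal.ofReal_pos.2 (by positivity)
  obtain ⟨N, δ, hδ, hN⟩ := exists_of_eventually_centralFilter (h.and (hB _ hε2))
  -- This is the second moment bound `2 n` divided by `(2 δ n) ^ 2`.
  have hlim : Tendsto (fun n : ℕ => 1 / (2 * δ ^ 2) / (n : ℝ)) atTop (𝓝 0) :=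
    tendsto_const_div_atTop_nhds_zero_nat _
  filter_upwards [eventually_ge_atTop N, eventually_ge_atTop 1,
    hlim.eventually (Iic_mem_nhds (half_pos hε))] with n hn hn1 hnδ
  have hn0 : (0 : ℝ) < n := by exact_mod_cast hn1
  set S : ℝ := ∑ m ∈ Finset.range (n + 1), baseMass n m
  have hS : 0 < S := Finset.sum_pos (fun m _ => baseMass_pos n m) ⟨0, by simp⟩
  -- Base points far from `n / 2` get the trivial event; their total mass is small by the second
  -- moment bound.
  set B' : ℕ → Set (Fin (n + 1) → ℝ) := fun m =>
    if |(m : ℝ) / n - 1 / 2| < δ then B n m else Set.univ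
  have hB' : ∀ m, MeasurableSet (B' m) := by
    intro m; simp only [B']; split_ifs
    · exact hBm n m
    · exact MeasurableSet.univ
  have hle := iidExp_convexSet_inter_le (negExp ⁻¹' A n) B' hB' (by
    intro m _ x hx hx0
    simp only [B']; split_ifs with hm
    · exact (hN n m hn hm).1 x hx0 hx
    · trivial)
  have hprob : ∀ m, baseLaw n m (B' m) ≤
      ENNReal.ofReal (ε / 2 + ((n : ℝ) - 2 * m) ^ 2 / (2 * δ * n) ^ 2) := by
    intro m
    simp only [B']; split_ifs with hm
    · exact ((hN n m hn hm).2).trans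
        (ENNReal.ofReal_le_ofReal (le_add_of_nonneg_right (by positivity)))
    · rw [measure_univ, ← ENNReal.ofReal_one]
      refine ENNReal.ofReal_le_ofReal ?_
      have h1 : (2 * δ * n) ^ 2 ≤ ((n : ℝ) - 2 * m) ^ 2 := by
        rw [sq_le_sq, abs_of_pos (by positivity : 0 < 2 * δ * n)]
        have : (n : ℝ) - 2 * m = -(2 * n) * ((m : ℝ) / n - 1 / 2) := by field_simp; ring
        rw [this, abs_mul, abs_neg, abs_of_pos (by positivity : (0 : ℝ) < 2 * n)]
        nlinarith [not_lt.1 hm]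
      have h2 : 1 ≤ ((n : ℝ) - 2 * m) ^ 2 / (2 * δ * n) ^ 2 := by
        rw [le_div_iff₀ (by positivity)]; linarith
      linarith
  have hreal : ∑ m ∈ Finset.range (n + 1),
      baseMass n m * (ε / 2 + ((n : ℝ) - 2 * m) ^ 2 / (2 * δ * n) ^ 2) ≤ ε * S := by
    have h1 := sum_baseMass_mul_sq_le n
    have h2 : ∑ m ∈ Finset.range (n + 1),
        baseMass n m * (ε / 2 + ((n : ℝ) - 2 * m) ^ 2 / (2 * δ * n) ^ 2) =
        ε / 2 * S + (∑ m ∈ Finset.range (n + 1), baseMass n m * ((n : ℝ) - 2 * m) ^ 2) /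
          (2 * δ * n) ^ 2 := by
      rw [Finset.mul_sum, Finset.sum_div, ← Finset.sum_add_distrib]
      exact Finset.sum_congr rfl fun m _ => by ring
    have h3 : (∑ m ∈ Finset.range (n + 1), baseMass n m * ((n : ℝ) - 2 * m) ^ 2) /
          (2 * δ * n) ^ 2 ≤ ε / 2 * S := by
      calc _ ≤ (2 * n * S) / (2 * δ * n) ^ 2 := by gcongr
        _ = (1 / (2 * δ ^ 2) / (n : ℝ)) * S := by field_simp
        _ ≤ ε / 2 * S := by
          have : 1 / (2 * δ ^ 2) / (n : ℝ) ≤ ε / 2 := hnδ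
          gcongr
    rw [h2]; linarith
  have hnum : iidExp n (convexSet n ∩ negExp ⁻¹' A n) ≤ ENNReal.ofReal (ε * S) := by
    refine hle.trans ((Finset.sum_le_sum fun m _ => mul_le_mul_right (hprob m) _).trans ?_)
    simp_rw [← ENNReal.ofReal_mul (baseMass_pos n _).le]
    rw [← ENNReal.ofReal_sum_of_nonneg fun m _ => mul_nonneg (baseMass_pos n m).le (by positivity)]
    exact ENNReal.ofReal_le_ofReal hreal
  have hden : ENNReal.ofReal S ≤ iidExp n (convexSet n) := by
    rw [ENNReal.ofReal_sum_of_nonneg fun m _ => (baseMass_pos n m).le]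
    exact sum_baseMass_le n
  rw [uniformModel_apply (hA n)]
  calc _ ≤ (ENNReal.ofReal S)⁻¹ * ENNReal.ofReal (ε * S) :=
        mul_le_mul' (ENNReal.inv_le_inv.2 hden) hnum
    _ = ENNReal.ofReal ε := by
        rw [← ENNReal.ofReal_inv_of_pos hS, ← ENNReal.ofReal_mul (by positivity)]
        congr 1; field_simp
    _ ≤ ε' := by rw [ENNReal.ofReal_coe_nnreal]; exact hε1.le

/-! ### The limit shape -/

/-- The coefficients expressing the `i`-th term of a sequence by its base point coordinates. -/
def baseCoeff (m i k : ℕ) : ℝ :=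
  if k = m then 1 else if m < k ∧ k ≤ i then (i : ℝ) - k + 1 else 0

lemma sum_baseCoeff_mul {n m i : ℕ} (hm : m ≤ i) (hi : i ≤ n) (F : ℕ → ℝ) :
    ∑ k ∈ Finset.range (n + 1), baseCoeff m i k * F k =
      F m + ∑ l ∈ Finset.range (i - m), (((i - m : ℕ) : ℝ) - l) * F (m + 1 + l) := by
  rw [sum_range_eq_sum_base (hm.trans hi)]
  have h1 : ∑ l ∈ Finset.range m, baseCoeff m i (m - 1 - l) * F (m - 1 - l) = 0 := by
    refine Finset.sum_eq_zero fun l hl => ?_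
    have := Finset.mem_range.1 hl
    rw [baseCoeff, if_neg (by omega), if_neg (by omega), zero_mul]
  have h2 : baseCoeff m i m = 1 := by simp [baseCoeff]
  rw [h1, h2, zero_add, one_mul]
  congr 1
  have h3 : ∑ l ∈ Finset.range (i - m), baseCoeff m i (m + 1 + l) * F (m + 1 + l) =
      ∑ l ∈ Finset.range (n - m), baseCoeff m i (m + 1 + l) * F (m + 1 + l) := by
    refine Finset.sum_subset (Finset.range_mono (by omega)) fun l _ hl => ?_
    rw [Finset.mem_range] at hl
    rw [baseCoeff, if_neg (by omega), if_neg (by omega), zero_mul]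
  rw [← h3]
  refine Finset.sum_congr rfl fun l hl => ?_
  have := Finset.mem_range.1 hl
  rw [baseCoeff, if_neg (by omega), if_pos (by omega), Nat.cast_sub hm]
  push_cast; ring

lemma extend_eq_sum_baseMap {n m i : ℕ} (hm : m ≤ i) (hi : i ≤ n) (x : Fin (n + 1) → ℝ) :
    extend x i = ∑ j : Fin (n + 1), baseCoeff m i j * baseMap n m x j := by
  have h := sum_baseCoeff_mul hm hi (baseCoord m (extend x))
  rw [← eq_add_sum_baseCoord, Nat.add_sub_cancel' hm, ← Fin.sum_univ_eq_sum_range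
    (fun k => baseCoeff m i k * baseCoord m (extend x) k)] at h
  simpa only [baseMap_apply] using h.symm

/-- With `j = κ + r + 1` the summand is `2 / (j + 1) - 2 κ (1 / j - 1 / (j + 1))`: a harmonic part
and a telescoping part. -/
lemma sum_div_eq_harmonic (κ k : ℕ) :
    ∑ r ∈ Finset.range k, 2 * ((r : ℝ) + 1) / ((κ + r + 1) * (κ + r + 2)) =
      2 * ((harmonic (κ + k + 1) : ℝ) - harmonic (κ + 1)) -
        2 * κ * (1 / (κ + 1) - 1 / (κ + k + 1)) := by
  induction k with
  | zero => simp
  | succ k ih =>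
    rw [Finset.sum_range_succ, ih, show κ + (k + 1) + 1 = (κ + k + 1) + 1 by ring,
      harmonic_succ (κ + k + 1)]
    push_cast
    field_simp
    ring

/-- The mean of the `i`-th term of the sequence, given the base point `m`. -/
lemma sum_baseCoeff_div_baseWeight {n m i : ℕ} (hm : m ≤ i) (hi : i ≤ n) :
    ∑ j : Fin (n + 1), baseCoeff m i j / baseWeight n m j =
      1 / ((n : ℝ) + 1) + (2 * ((harmonic (n - m + 1) : ℝ) - harmonic (n - i + 1)) -
        2 * (n - i : ℕ) * (1 / ((n - i : ℕ) + 1) - 1 / ((n - m : ℕ) + 1))) := by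
  rw [Fin.sum_univ_eq_sum_range (fun k => baseCoeff m i k / baseWeight n m k)]
  simp_rw [div_eq_mul_inv (baseCoeff _ _ _)]
  rw [sum_baseCoeff_mul hm hi (fun k => (baseWeight n m k)⁻¹), baseWeight_self, one_div]
  congr 1
  have h := sum_div_eq_harmonic (n - i) (i - m)
  rw [show n - i + (i - m) = n - m by omega] at h
  have hc : ((n - i : ℕ) : ℝ) + (i - m : ℕ) = (n - m : ℕ) := by
    rw [← Nat.cast_add]; congr 1; omega
  rw [hc] at h
  -- Counting down from `i` turns the coefficient into `r + 1` and the weight into `(n - i + r + 1)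
  -- (n - i + r + 2) / 2`.
  rw [← h, ← Finset.sum_range_reflect]
  refine Finset.sum_congr rfl fun l hl => ?_
  have hl' := Finset.mem_range.1 hl
  rw [baseWeight_right]
  have e1 : ((i - m - 1 - l : ℕ) : ℝ) = (i : ℝ) - m - 1 - l := by
    rw [Nat.cast_sub (by omega), Nat.cast_sub (by omega), Nat.cast_sub (by omega)]; simp
  rw [e1, Nat.cast_sub hm, Nat.cast_sub hi]
  have e2 : (n : ℝ) - m - (i - m - 1 - l) = n - i + l + 1 := by ring
  rw [e2, inv_div]
  ring

/-- Bounds the standard deviation of each summand. When `n - i` is of order `n`, the `n + 1`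
variances add up to `O(1 / n)`. -/
lemma baseCoeff_div_baseWeight_le {n m i k : ℕ} (hi : i ≤ n) :
    |baseCoeff m i k / baseWeight n m k| ≤ 2 / ((n : ℝ) - i + 1) := by
  have hi' : (i : ℝ) ≤ n := by exact_mod_cast hi
  have hpos : 0 < (n : ℝ) - i + 1 := by linarith
  unfold baseCoeff baseWeight
  by_cases h1 : k = m
  · rw [if_pos h1, if_pos h1, abs_of_pos (by positivity)]
    rw [div_le_div_iff₀ (by positivity) hpos]
    have : (0 : ℝ) ≤ i := by positivity
    nlinarith
  rw [if_neg h1, if_neg h1]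
  by_cases h2 : m < k ∧ k ≤ i
  · rw [if_pos h2, if_pos h2.1]
    have hk : (k : ℝ) ≤ i := by exact_mod_cast h2.2
    have a1 : 0 < (n : ℝ) - k + 1 := by linarith
    have a2 : 0 < (n : ℝ) - k + 2 := by linarith
    have a3 : 0 < (i : ℝ) - k + 1 := by linarith
    rw [abs_of_pos (by positivity), div_le_div_iff₀ (by positivity) hpos]
    have : ((i : ℝ) - k + 1) * (n - i + 1) ≤ (n - k + 1) * (n - k + 2) := by
      apply mul_le_mul <;> linarith
    linarith
  · rw [if_neg h2, zero_div, abs_zero]; positivity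

/-- The limit shape to the right of its minimum. -/
noncomputable def shape (t : ℝ) : ℝ := 2 - 4 * t - 2 * Real.log (2 - 2 * t)

section Limits

variable {α : Type*} {l : Filter α} {N : α → ℕ}

/-- Euler's constant cancels in the difference. -/
lemma tendsto_harmonic_sub_harmonic (hN : Tendsto N l atTop) {a b : α → ℕ} {A B : ℝ}
    (hA : 0 < A) (hB : 0 < B) (ha : Tendsto (fun p => (a p : ℝ) / N p) l (𝓝 A))
    (hb : Tendsto (fun p => (b p : ℝ) / N p) l (𝓝 B)) :
    Tendsto (fun p => (harmonic (a p) : ℝ) - harmonic (b p)) l (𝓝 (Real.log (A / B))) := by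
  have hNr : Tendsto (fun p => (N p : ℝ)) l atTop := tendsto_natCast_atTop_atTop.comp hN
  have htop : ∀ {a : α → ℕ} {A : ℝ}, 0 < A → Tendsto (fun p => (a p : ℝ) / N p) l (𝓝 A) →
      Tendsto a l atTop := by
    intro a A hA ha
    have h1 : Tendsto (fun p => (a p : ℝ) / N p * N p) l atTop := ha.pos_mul_atTop hA hNr
    refine tendsto_natCast_atTop_iff.1 (h1.congr' ?_)
    filter_upwards [hN.eventually_gt_atTop 0] with p hp
    have : (N p : ℝ) ≠ 0 := by exact_mod_cast hp.ne'
    field_simp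
  have h1 := (Real.tendsto_harmonic_sub_log.comp (htop hA ha)).sub
    (Real.tendsto_harmonic_sub_log.comp (htop hB hb))
  have h2 := (ha.div hb hB.ne').log (div_pos hA hB).ne'
  have h3 := h1.add h2
  rw [sub_self, zero_add] at h3
  refine h3.congr' ?_
  filter_upwards [hN.eventually_gt_atTop 0, (htop hA ha).eventually_gt_atTop 0,
    (htop hB hb).eventually_gt_atTop 0] with p hp hap hbp
  have e1 : (N p : ℝ) ≠ 0 := by exact_mod_cast hp.ne'
  have e2 : (a p : ℝ) ≠ 0 := by exact_mod_cast hap.ne'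
  have e3 : (b p : ℝ) ≠ 0 := by exact_mod_cast hbp.ne'
  have : (a p : ℝ) / N p / (b p / N p) = a p / b p := by field_simp
  simp only [Function.comp, Pi.div_apply, this, Real.log_div e2 e3]
  ring

end Limits

section Index

variable {t : ℝ}

lemma tendsto_floor_centralFilter (ht0 : 0 ≤ t) :
    Tendsto (fun p : ℕ × ℕ => (⌊t * p.1⌋₊ : ℝ) / p.1) centralFilter (𝓝 t) :=
  (tendsto_nat_floor_mul_div_atTop ht0).comp
    (tendsto_natCast_atTop_atTop.comp tendsto_fst_centralFilter)

lemma eventually_lt_floor (ht : 1 / 2 < t) (ht1 : t < 1) :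
    ∀ᶠ p : ℕ × ℕ in centralFilter, p.2 < ⌊t * p.1⌋₊ ∧ ⌊t * p.1⌋₊ < p.1 := by
  obtain ⟨s, hs1, hs2⟩ := exists_between ht
  filter_upwards [tendsto_fst_centralFilter.eventually_gt_atTop 0,
    (tendsto_floor_centralFilter (by linarith : 0 ≤ t)).eventually_const_lt hs2,
    (tendsto_floor_centralFilter (by linarith : 0 ≤ t)).eventually_lt_const ht1,
    tendsto_div_centralFilter.eventually_lt_const hs1] with p h0 h1 h2 h3
  have h0' : (0 : ℝ) < p.1 := by exact_mod_cast h0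
  constructor
  · have := h3.trans h1
    rw [div_lt_div_iff_of_pos_right h0'] at this
    exact_mod_cast this
  · rw [div_lt_one h0'] at h2
    exact_mod_cast h2

lemma tendsto_inv_fst : Tendsto (fun p : ℕ × ℕ => 1 / (p.1 : ℝ)) centralFilter (𝓝 0) :=
  tendsto_one_div_atTop_nhds_zero_nat.comp tendsto_fst_centralFilter

lemma tendsto_sub_floor_div (ht : 1 / 2 < t) (ht1 : t < 1) :
    Tendsto (fun p : ℕ × ℕ => ((p.1 - ⌊t * p.1⌋₊ : ℕ) : ℝ) / p.1) centralFilter (𝓝 (1 - t)) := by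
  refine ((tendsto_floor_centralFilter (by linarith : 0 ≤ t)).const_sub 1).congr' ?_
  filter_upwards [tendsto_fst_centralFilter.eventually_gt_atTop 0,
    eventually_lt_floor ht ht1] with p h0 h
  have h0' : (p.1 : ℝ) ≠ 0 := by exact_mod_cast h0.ne'
  rw [Nat.cast_sub h.2.le]
  field_simp

lemma tendsto_sub_base_div :
    Tendsto (fun p : ℕ × ℕ => ((p.1 - p.2 : ℕ) : ℝ) / p.1) centralFilter (𝓝 (1 / 2)) := by
  have h := tendsto_div_centralFilter.const_sub 1
  rw [show (1 : ℝ) - 1 / 2 = 1 / 2 by norm_num] at h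
  refine h.congr' ?_
  filter_upwards [tendsto_fst_centralFilter.eventually_gt_atTop 0,
    tendsto_div_centralFilter.eventually_lt_const (by norm_num : (1 : ℝ) / 2 < 1)] with p h0 h
  have h0' : (0 : ℝ) < p.1 := by exact_mod_cast h0
  rw [div_lt_one h0'] at h
  have h' : p.2 ≤ p.1 := by exact_mod_cast h.le
  rw [Nat.cast_sub h']
  field_simp

lemma tendsto_succ_div {a : ℕ × ℕ → ℕ} {A : ℝ}
    (ha : Tendsto (fun p : ℕ × ℕ => (a p : ℝ) / p.1) centralFilter (𝓝 A)) :
    Tendsto (fun p : ℕ × ℕ => ((a p + 1 : ℕ) : ℝ) / p.1) centralFilter (𝓝 A) := by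
  have := ha.add tendsto_inv_fst
  rw [add_zero] at this
  refine this.congr fun p => ?_
  push_cast; ring

/-- Source of `shape`: with `n - i ~ (1 - t) n` and `n - m ~ n / 2`, the harmonic part tends to `-2
log (2 - 2 t)` and the rational part to `2 - 4 t`. -/
lemma tendsto_mean (ht : 1 / 2 < t) (ht1 : t < 1) :
    Tendsto (fun p : ℕ × ℕ => ∑ j : Fin (p.1 + 1),
      baseCoeff p.2 ⌊t * p.1⌋₊ j / baseWeight p.1 p.2 j) centralFilter (𝓝 (shape t)) := by
  have hF := tendsto_fst_centralFilter
  have h1t : 0 < 1 - t := by linarith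
  have ha := tendsto_sub_base_div
  have hb := tendsto_sub_floor_div ht ht1
  have ha' := tendsto_succ_div ha
  have hb' := tendsto_succ_div hb
  have l1 : Tendsto (fun p : ℕ × ℕ => 1 / ((p.1 : ℝ) + 1)) centralFilter (𝓝 0) :=
    tendsto_one_div_add_atTop_nhds_zero_nat.comp hF
  have l2 := tendsto_harmonic_sub_harmonic hF one_half_pos h1t ha' hb'
  have l3 := hb.div hb' h1t.ne'
  have l4 := hb.div ha' one_half_pos.ne'
  have hlim := l1.add ((l2.const_mul 2).sub ((l3.sub l4).const_mul 2))
  have hval : 0 + (2 * Real.log (1 / 2 / (1 - t)) - 2 * ((1 - t) / (1 - t) - (1 - t) / (1 / 2))) =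
      shape t := by
    rw [shape, div_self h1t.ne', show (1 : ℝ) / 2 / (1 - t) = (2 - 2 * t)⁻¹ by field_simp,
      Real.log_inv]
    ring
  rw [hval] at hlim
  refine hlim.congr' ?_
  filter_upwards [hF.eventually_gt_atTop 0, eventually_lt_floor ht ht1] with p h0 h
  have h0' : (p.1 : ℝ) ≠ 0 := by exact_mod_cast h0.ne'
  rw [sum_baseCoeff_div_baseWeight h.1.le h.2.le]
  simp only [Pi.div_apply]
  push_cast
  field_simp

lemma tendsto_baseLaw_deviation (ht : 1 / 2 < t) (ht1 : t < 1) {ε : ℝ} (hε : 0 < ε) :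
    Tendsto (fun p : ℕ × ℕ => baseLaw p.1 p.2 {y | ε ≤ |∑ j : Fin (p.1 + 1),
      baseCoeff p.2 ⌊t * p.1⌋₊ j * y j - ∑ j : Fin (p.1 + 1),
        baseCoeff p.2 ⌊t * p.1⌋₊ j / baseWeight p.1 p.2 j|}) centralFilter (𝓝 0) := by
  have h1t : 0 < 1 - t := by linarith
  have hb' := tendsto_succ_div (tendsto_sub_floor_div ht ht1)
  have l1 : Tendsto (fun p : ℕ × ℕ => 4 * (1 / (p.1 : ℝ) + (1 / (p.1 : ℝ)) ^ 2) /
      (((p.1 - ⌊t * p.1⌋₊ + 1 : ℕ) : ℝ) / p.1) ^ 2 / ε ^ 2) centralFilter (𝓝 0) := by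
    have := (((tendsto_inv_fst.add (tendsto_inv_fst.pow 2)).const_mul 4).div (hb'.pow 2)
      (pow_ne_zero 2 h1t.ne')).div_const (ε ^ 2)
    simpa using this
  have l2 := ENNReal.tendsto_ofReal l1
  rw [ENNReal.ofReal_zero] at l2
  refine tendsto_of_tendsto_of_tendsto_of_le_of_le' tendsto_const_nhds l2
    (Eventually.of_forall fun _ => zero_le) ?_
  filter_upwards [tendsto_fst_centralFilter.eventually_gt_atTop 0,
    eventually_lt_floor ht ht1] with p h0 h
  refine (pi_expMeasure_abs_sum_sub_le (baseWeight_coe_pos p.2) _ hε).trans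
    (ENNReal.ofReal_le_ofReal ?_)
  gcongr
  have h0' : (0 : ℝ) < p.1 := by exact_mod_cast h0
  have hfl : (⌊t * p.1⌋₊ : ℝ) < p.1 := by exact_mod_cast h.2
  have hpos : (0 : ℝ) < (p.1 : ℝ) - ⌊t * p.1⌋₊ + 1 := by linarith
  calc ∑ j : Fin (p.1 + 1), (baseCoeff p.2 ⌊t * p.1⌋₊ j / baseWeight p.1 p.2 j) ^ 2
      ≤ ∑ j : Fin (p.1 + 1), (2 / ((p.1 : ℝ) - ⌊t * p.1⌋₊ + 1)) ^ 2 := by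
        refine Finset.sum_le_sum fun j _ => ?_
        rw [← sq_abs]
        exact pow_le_pow_left₀ (abs_nonneg _) (baseCoeff_div_baseWeight_le h.2.le) 2
    _ = 4 * (1 / (p.1 : ℝ) + (1 / (p.1 : ℝ)) ^ 2) /
      (((p.1 - ⌊t * p.1⌋₊ + 1 : ℕ) : ℝ) / p.1) ^ 2 := by
        rw [Finset.sum_const, Finset.card_univ, Fintype.card_fin, nsmul_eq_mul]
        push_cast [Nat.cast_sub h.2.le]
        field_simp
        ring

lemma measurable_extend {n : ℕ} (k : ℕ) : Measurable fun x : Fin (n + 1) → ℝ => extend x k := by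
  unfold extend
  split_ifs
  · fun_prop
  · exact measurable_const

lemma extend_negExp {n k : ℕ} (hk : k ≤ n) (x : Fin (n + 1) → ℝ) :
    extend (negExp x) k = Real.exp (-extend x k) := by
  rw [extend_of_le _ hk, extend_of_le _ hk, negExp]

/-- The law of large numbers for the logarithms of the coefficients in the uniform model. -/
theorem tendsto_uniformModel_abs_sub_shape (ht : 1 / 2 < t) (ht1 : t < 1) {ε : ℝ} (hε : 0 < ε) :
    Tendsto (fun n => uniformModel n {a | ε ≤ |-Real.log (extend a ⌊t * n⌋₊) - shape t|})
      atTop (𝓝 0) := by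
  refine tendsto_uniformModel_zero _ (fun n => ?_) (fun n m => {y | ε / 2 ≤ |∑ j : Fin (n + 1),
      baseCoeff m ⌊t * n⌋₊ j * y j - ∑ j : Fin (n + 1),
        baseCoeff m ⌊t * n⌋₊ j / baseWeight n m j|}) (fun n m => ?_) ?_
    (tendsto_baseLaw_deviation ht ht1 (half_pos hε))
  · have := measurable_extend (n := n) ⌊t * n⌋₊
    exact measurableSet_le measurable_const (by fun_prop)
  · exact measurableSet_le measurable_const (by fun_prop)
  · filter_upwards [eventually_lt_floor ht ht1, (Metric.tendsto_nhds.1 (tendsto_mean ht ht1)) _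
      (half_pos hε)] with p h hmean x _ hx
    rw [extend_negExp h.2.le, Real.log_exp, neg_neg] at hx
    rw [← extend_eq_sum_baseMap h.1.le h.2.le]
    rw [Real.dist_eq] at hmean
    have := abs_sub_le (extend x ⌊t * p.1⌋₊) (∑ j : Fin (p.1 + 1),
      baseCoeff p.2 ⌊t * p.1⌋₊ j / baseWeight p.1 p.2 j) (shape t)
    linarith

end Index

/-! ### Strict log-concavity at a given index -/

lemma measurable_lt_extend {n : ℕ} (i : ℕ) (κ : ℝ) : MeasurableSet {a : Fin (n + 1) → ℝ |
    Real.exp (-κ) * extend a i ^ 2 < extend a (i - 1) * extend a (i + 1)} := by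
  have h1 := measurable_extend (n := n) i
  have h2 := measurable_extend (n := n) (i - 1)
  have h3 := measurable_extend (n := n) (i + 1)
  exact measurableSet_lt (by fun_prop) (by fun_prop)

lemma baseLaw_extend_le {n m k : ℕ} (hm : m < k) (hk : k ≤ n) {κ : ℝ} (hκ : 0 ≤ κ) :
    baseLaw n m {y | extend y k ≤ κ} ≤ ENNReal.ofReal ((n + 1) ^ 2 * κ) := by
  have := fun i : Fin (n + 1) => isProbabilityMeasure_expMeasure (baseWeight_coe_pos m i)
  have h1 : {y : Fin (n + 1) → ℝ | extend y k ≤ κ} =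
      (fun y => y ⟨k, Nat.lt_succ_of_le hk⟩) ⁻¹' Set.Iic κ := by
    ext y; simp [extend_of_le y hk]
  rw [h1, baseLaw, (measurePreserving_eval (fun i : Fin (n + 1) => expMeasure (baseWeight n m i))
    ⟨k, Nat.lt_succ_of_le hk⟩).measure_preimage measurableSet_Iic.nullMeasurableSet]
  refine (expMeasure_Iic_le (baseWeight_coe_pos m _) κ).trans (ENNReal.ofReal_le_ofReal ?_)
  refine mul_le_mul_of_nonneg_right ?_ hκ
  have hk' : (k : ℝ) ≤ n := by exact_mod_cast hk
  have hk1 : (1 : ℝ) ≤ k := by exact_mod_cast (by omega : 1 ≤ k)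
  simp only [baseWeight]
  rw [if_neg (by omega), if_pos hm]
  nlinarith

/-- On this event the second difference centred at `i`, which is base point coordinate `i + 1`, is
below `(n + 1)^{-3}`. Its rate is at most `(n + 1)^2`, so the probability is at most `1 / (n + 1)`.
-/
lemma tendsto_uniformModel_lt_mul {t : ℝ} (ht : 1 / 2 < t) (ht1 : t < 1) :
    Tendsto (fun n : ℕ => uniformModel n {a | Real.exp (-(1 / ((n : ℝ) + 1) ^ 3)) *
      extend a ⌊t * n⌋₊ ^ 2 < extend a (⌊t * n⌋₊ - 1) * extend a (⌊t * n⌋₊ + 1)})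
      atTop (𝓝 0) := by
  refine tendsto_uniformModel_zero _ (fun n => measurable_lt_extend _ _)
    (fun n m => {y | extend y (⌊t * n⌋₊ + 1) ≤ 1 / ((n : ℝ) + 1) ^ 3}) (fun n m => ?_) ?_ ?_
  · exact measurableSet_le (measurable_extend _) measurable_const
  · filter_upwards [eventually_lt_floor ht ht1] with p h x _ hx
    set i := ⌊t * p.1⌋₊
    rw [extend_negExp h.2.le, extend_negExp (by omega), extend_negExp h.2, ← Real.exp_nat_mul,
      ← Real.exp_add, ← Real.exp_add, Real.exp_lt_exp] at hx
    push_cast at hx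
    obtain ⟨l, hl⟩ := Nat.exists_eq_add_of_lt h.1
    rw [extend_of_le _ (Nat.succ_le_of_lt h.2), baseMap_apply]
    simp only [Nat.succ_eq_add_one]
    rw [show i + 1 = p.2 + 1 + (l + 1) by omega, baseCoord_right]
    simp only [secondDiff]
    rw [show p.2 + (l + 2) = i + 1 by omega, show p.2 + (l + 1) = i by omega,
      show p.2 + l = i - 1 by omega]
    linarith
  · have l1 : Tendsto (fun p : ℕ × ℕ => ENNReal.ofReal (1 / ((p.1 : ℝ) + 1))) centralFilter
        (𝓝 0) := by
      have := ENNReal.tendsto_ofReal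
        (tendsto_one_div_add_atTop_nhds_zero_nat.comp tendsto_fst_centralFilter)
      rwa [ENNReal.ofReal_zero] at this
    refine tendsto_of_tendsto_of_tendsto_of_le_of_le' tendsto_const_nhds l1
      (Eventually.of_forall fun _ => zero_le) ?_
    filter_upwards [eventually_lt_floor ht ht1] with p h
    refine (baseLaw_extend_le (by omega) h.2 (by positivity)).trans_eq ?_
    congr 1
    field_simp

/-! ### Almost sure properties of the uniform model -/

lemma ae_uniformModel_mem (n : ℕ) : ∀ᵐ a ∂uniformModel n, a ∈ logConcaveSet n ∧
    ∀ i, a i ∈ Set.Ioo (0 : ℝ) 1 := by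
  have h1 : ∀ᵐ a ∂uniformModel n, a ∈ logConcaveSet n := ae_cond_mem (measurableSet_logConcaveSet n)
  have h2 : ∀ᵐ a ∂iidUniform n, ∀ i, a i ∈ Set.Ioo (0 : ℝ) 1 := by
    refine ae_all_iff.2 fun i => ?_
    have h : ∀ᵐ x ∂(volume : Measure ℝ).restrict (Set.Ioo 0 1), x ∈ Set.Ioo (0 : ℝ) 1 :=
      ae_restrict_mem measurableSet_Ioo
    exact (Measure.tendsto_eval_ae_ae (μ := fun _ : Fin (n + 1) =>
      (volume : Measure ℝ).restrict (Set.Ioo 0 1)) (i := i)).eventually h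
  have h3 : ∀ᵐ a ∂uniformModel n, ∀ i, a i ∈ Set.Ioo (0 : ℝ) 1 :=
    cond_absolutelyContinuous.ae_le h2
  exact h1.and h3

lemma convexSeq_neg_log {n : ℕ} {a : Fin (n + 1) → ℝ} (ha : a ∈ logConcaveSet n)
    (h0 : ∀ i, 0 < a i) : ConvexSeq n fun k => -Real.log (extend a k) := by
  have h : negExp (fun i => -Real.log (a i)) = a := by
    ext i; simp [negExp, Real.exp_log (h0 i)]
  have h1 : (fun i => -Real.log (a i)) ∈ convexSet n := by
    rw [← negExp_preimage_logConcaveSet, Set.mem_preimage, h]; exact ha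
  intro k hk
  have h2 := h1 k hk
  simpa only [extend_of_le _ hk, extend_of_le _ (by omega : k ≤ n),
    extend_of_le _ (by omega : k + 1 ≤ n)] using h2

/-! ### Chords of convex sequences -/

lemma ConvexSeq.slope_mono {n : ℕ} {g : ℕ → ℝ} (hg : ConvexSeq n g) {k j : ℕ} (hkj : k ≤ j)
    (hj : j < n) : g (k + 1) - g k ≤ g (j + 1) - g j := by
  induction j, hkj using Nat.le_induction with
  | base => rfl
  | succ j hkj ih => linarith [hg j hj, ih (by omega)]

lemma ConvexSeq.add_slope_mul_le {n : ℕ} {g : ℕ → ℝ} (hg : ConvexSeq n g) {k j : ℕ} (hk : k < n)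
    (hj : j ≤ n) : g k + ((j : ℝ) - k) * (g (k + 1) - g k) ≤ g j := by
  rcases le_total k j with h | h
  · induction j, h using Nat.le_induction with
    | base => simp
    | succ j hkj ih =>
      have h1 := ih (by omega)
      have h2 := hg.slope_mono hkj (by omega)
      push_cast
      linarith
  · induction h using Nat.decreasingInduction with
    | self => simp
    | of_succ j hjk ih =>
      have h1 := ih (by omega)
      have h2 := hg.slope_mono hjk.le hk
      push_cast at h1
      linarith

/-- For `q < r`, both chords are compared with the line through `q` of slope `g (q + 1) - g q`. The
division-free form allows equal indices. -/
lemma ConvexSeq.chord_le {n : ℕ} {g : ℕ → ℝ} (hg : ConvexSeq n g) {p q r : ℕ} (hpq : p ≤ q)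
    (hqr : q ≤ r) (hr : r ≤ n) :
    (g q - g p) * ((r : ℝ) - q) ≤ (g r - g q) * ((q : ℝ) - p) := by
  rcases hqr.eq_or_lt with rfl | hqr'
  · simp
  have h1 := hg.add_slope_mul_le (hqr'.trans_le hr) hr
  have h2 := hg.add_slope_mul_le (hqr'.trans_le hr) (hpq.trans (hqr.trans hr))
  have e1 : (p : ℝ) ≤ q := by exact_mod_cast hpq
  have e2 : (q : ℝ) ≤ r := by exact_mod_cast hqr
  nlinarith

/-- If the slope of a convex sequence at `q` is close to `lam / n`, then `i ↦ lam i - n g i` is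
nearly maximal at `q`. -/
lemma ConvexSeq.mul_sub_le {n : ℕ} {g : ℕ → ℝ} (hg : ConvexSeq n g) {p q r : ℕ} (hpq : p < q)
    (hqr : q < r) (hr : r ≤ n) {lam η : ℝ} (hη : 0 ≤ η)
    (h1 : (lam - η) * ((q : ℝ) - p) ≤ n * (g q - g p))
    (h2 : n * (g r - g q) ≤ (lam + η) * ((r : ℝ) - q)) {i : ℕ} (hi : i ≤ n) :
    lam * i - n * g i ≤ lam * q - n * g q + η * n := by
  have e1 : (p : ℝ) < q := by exact_mod_cast hpq
  have e2 : (q : ℝ) < r := by exact_mod_cast hqr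
  have e3 : (r : ℝ) ≤ n := by exact_mod_cast hr
  have e4 : (i : ℝ) ≤ n := by exact_mod_cast hi
  have hn : (0 : ℝ) ≤ n := by positivity
  have hi0 : (0 : ℝ) ≤ i := by positivity
  have hp0 : (0 : ℝ) ≤ p := by positivity
  rcases le_total q i with h | h
  · have e5 : (q : ℝ) ≤ i := by exact_mod_cast h
    have h3 := mul_le_mul_of_nonneg_left (hg.chord_le hpq.le h hi) hn
    have h4 := mul_le_mul_of_nonneg_right h1 (sub_nonneg.2 e5)
    have h5 : (lam - η) * ((i : ℝ) - q) ≤ n * (g i - g q) := by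
      refine le_of_mul_le_mul_right ?_ (sub_pos.2 e1)
      linarith
    nlinarith
  · have e5 : (i : ℝ) ≤ q := by exact_mod_cast h
    have h3 := mul_le_mul_of_nonneg_left (hg.chord_le h hqr.le hr) hn
    have h4 := mul_le_mul_of_nonneg_right h2 (sub_nonneg.2 e5)
    have h5 : n * (g q - g i) ≤ (lam + η) * ((q : ℝ) - i) := by
      refine le_of_mul_le_mul_right ?_ (sub_pos.2 e2)
      linarith
    nlinarith

/-! ### The limiting potential -/

/-- The limiting potential as a function of `log |z|`. -/
noncomputable def potential (lam : ℝ) : ℝ := max lam 0 + 2 * Real.log (4 / (4 + |lam|))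

lemma G_eq_potential {z : ℂ} (hz : z ≠ 0) : G z = potential (Real.log ‖z‖) := by
  have hz' : 0 < ‖z‖ := norm_pos_iff.2 hz
  unfold G potential
  split_ifs with h
  · have := Real.log_nonpos hz'.le h
    rw [max_eq_right this, abs_of_nonpos this, zero_add]; rfl
  · have := Real.log_nonneg (not_le.1 h).le
    rw [max_eq_left this, abs_of_nonneg this]

lemma continuous_potential : Continuous potential := by
  unfold potential
  refine (continuous_id.max continuous_const).add (continuous_const.mul ?_)
  have h : ∀ x : ℝ, 4 + |x| ≠ 0 := fun x => by positivity
  exact (continuous_const.div (continuous_const.add continuous_abs) h).log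
    fun x => div_ne_zero (by norm_num) (h x)

lemma potential_zero : potential 0 = 0 := by simp [potential]

/-- The counterpart of replacing `P` by its reversal `z ^ n P(1 / z)`. -/
lemma potential_neg (lam : ℝ) : potential (-lam) = potential lam - lam := by
  unfold potential
  rw [abs_neg]
  rcases le_total lam 0 with h | h
  · rw [max_eq_left (by linarith), max_eq_right h]; ring
  · rw [max_eq_right (by linarith), max_eq_left h]; ring

/-- The point at which the supremum of `lam * t - shape t` is attained. -/
noncomputable def peak (lam : ℝ) : ℝ := 1 - 2 / (4 + lam)

lemma half_lt_peak {lam : ℝ} (h : 0 < lam) : 1 / 2 < peak lam := by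
  have : 2 / (4 + lam) < 1 / 2 := by rw [div_lt_div_iff₀ (by linarith) (by norm_num)]; linarith
  unfold peak; linarith

lemma peak_lt_one {lam : ℝ} (h : 0 ≤ lam) : peak lam < 1 := by
  have : 0 < 2 / (4 + lam) := by positivity
  unfold peak; linarith

lemma half_le_peak {lam : ℝ} (h : 0 ≤ lam) : 1 / 2 ≤ peak lam := by
  rcases h.eq_or_lt with rfl | h
  · norm_num [peak]
  · exact (half_lt_peak h).le

/-- The potential is the Legendre transform of `shape`; `peak lam` solves `shape' = lam`. -/
lemma potential_eq {lam : ℝ} (h : 0 ≤ lam) :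
    potential lam = lam * peak lam - shape (peak lam) := by
  have h4 : (4 : ℝ) + lam ≠ 0 := by positivity
  have e : 2 - 2 * peak lam = 4 / (4 + lam) := by unfold peak; ring
  rw [shape, e, potential, max_eq_left h, abs_of_nonneg h]
  unfold peak
  field_simp
  ring

lemma hasDerivAt_shape {lam : ℝ} (h : 0 ≤ lam) : HasDerivAt shape lam (peak lam) := by
  have h4 : (4 : ℝ) + lam ≠ 0 := by positivity
  have e : 2 - 2 * peak lam = 4 / (4 + lam) := by unfold peak; ring
  have hne : 2 - 2 * peak lam ≠ 0 := by rw [e]; positivity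
  have h1 : HasDerivAt (fun t : ℝ => 2 - 2 * t) (-2) (peak lam) := by
    simpa using ((hasDerivAt_id (peak lam)).const_mul 2).const_sub 2
  have h2 : HasDerivAt (fun t : ℝ => 2 - 4 * t) (-4) (peak lam) := by
    simpa using ((hasDerivAt_id (peak lam)).const_mul 4).const_sub 2
  have h3 := h2.sub ((h1.log hne).const_mul 2)
  convert! h3 using 1
  rw [e]; field_simp; ring

/-! ### Upper bound for the terms of the polynomial -/

/-- The coefficient vectors for which some term of the polynomial is larger than predicted on the
circle of radius `exp lam`. -/
def largeTerm (n : ℕ) (lam ε : ℝ) : Set (Fin (n + 1) → ℝ) :=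
  {b | ∃ i : Fin (n + 1), Real.exp (n * (potential lam + ε)) < |b i| * Real.exp (lam * i)}

lemma measurableSet_largeTerm (n : ℕ) (lam ε : ℝ) : MeasurableSet (largeTerm n lam ε) := by
  have : largeTerm n lam ε = ⋃ i : Fin (n + 1),
      {b | Real.exp (n * (potential lam + ε)) < |b i| * Real.exp (lam * i)} := by
    ext b; simp [largeTerm]
  rw [this]
  exact MeasurableSet.iUnion fun i => measurableSet_lt measurable_const (by fun_prop)

/-- Chords of `shape` ending at the peak have slope close to its derivative `lam`. The strict
inequalities leave slack for random errors. -/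
lemma exists_chord_shape {lam η : ℝ} (hlam : 0 < lam) (hη : 0 < η) :
    (∃ t, 1 / 2 < t ∧ t < peak lam ∧
      (lam - η) * (peak lam - t) < shape (peak lam) - shape t) ∧
    ∃ t, peak lam < t ∧ t < 1 ∧ shape t - shape (peak lam) < (lam + η) * (t - peak lam) := by
  have h := hasDerivAt_iff_tendsto_slope.1 (hasDerivAt_shape hlam.le)
  constructor
  · have h1 := (h.mono_left (nhdsLT_le_nhdsNE _)).eventually_const_lt (sub_lt_self lam hη)
    obtain ⟨t, ht, ht'⟩ := (h1.and (Ioo_mem_nhdsLT (half_lt_peak hlam))).exists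
    refine ⟨t, ht'.1, ht'.2, ?_⟩
    rw [slope_comm, slope_def_field, lt_div_iff₀ (sub_pos.2 ht'.2)] at ht
    exact ht
  · have h1 := (h.mono_left (nhdsGT_le_nhdsNE _)).eventually_lt_const (lt_add_of_pos_right lam hη)
    obtain ⟨t, ht, ht'⟩ := (h1.and (Ioo_mem_nhdsGT (peak_lt_one hlam.le))).exists
    refine ⟨t, ht'.1, ht'.2, ?_⟩
    rw [slope_def_field, div_lt_iff₀ (sub_pos.2 ht'.1)] at ht
    exact ht

lemma tendsto_floor_div {t : ℝ} (ht : 0 ≤ t) :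
    Tendsto (fun n : ℕ => (⌊t * n⌋₊ : ℝ) / n) atTop (𝓝 t) :=
  (tendsto_nat_floor_mul_div_atTop ht).comp tendsto_natCast_atTop_atTop

lemma eventually_floor_lt_floor {s t : ℝ} (hs : 0 ≤ s) (hst : s < t) :
    ∀ᶠ n : ℕ in atTop, ⌊s * n⌋₊ < ⌊t * n⌋₊ := by
  obtain ⟨r, h1, h2⟩ := exists_between hst
  filter_upwards [eventually_gt_atTop 0, (tendsto_floor_div hs).eventually_lt_const h1,
    (tendsto_floor_div (hs.trans hst.le)).eventually_const_lt h2] with n h0 h3 h4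
  have := h3.trans h4
  rw [div_lt_div_iff_of_pos_right (by exact_mod_cast h0)] at this
  exact_mod_cast this

lemma neg_log_eq_of_lt {n i : ℕ} {a lam c : ℝ} (ha : 0 < a)
    (h : Real.exp (n * c) < |a ^ n| * Real.exp (lam * i)) :
    n * c < lam * i - n * -Real.log a := by
  rw [abs_of_pos (by positivity), ← Real.exp_log (pow_pos ha n), ← Real.exp_add, Real.exp_lt_exp,
    Real.log_pow] at h
  linarith

lemma tendsto_uniformModel_largeTerm_of_pos {lam ε : ℝ} (hlam : 0 < lam) (hε : 0 < ε) :
    Tendsto (fun n : ℕ => uniformModel n {a | (fun i => a i ^ n) ∈ largeTerm n lam ε})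
      atTop (𝓝 0) := by
  set η := ε / 2
  have hη : 0 < η := half_pos hε
  obtain ⟨⟨t₁, h1, h1', hs1⟩, ⟨t₂, h2, h2', hs2⟩⟩ := exists_chord_shape hlam hη
  set t := peak lam
  have ht : 1 / 2 < t := half_lt_peak hlam
  have ht' : t < 1 := peak_lt_one hlam.le
  -- Each chord inequality has slack at least `3 κ`: two parts absorb the deviations at its
  -- endpoints, the third the rounding of indices. The bound `κ ≤ η` gives `η + κ ≤ ε` at the end.
  set κ := min η (min ((shape t - shape t₁ - (lam - η) * (t - t₁)) / 3)
    (((lam + η) * (t₂ - t) - (shape t₂ - shape t)) / 3))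
  have hκ : 0 < κ := lt_min hη (lt_min (by linarith) (by linarith))
  have hκ1 : κ ≤ η := min_le_left _ _
  have hκ2 : κ ≤ (shape t - shape t₁ - (lam - η) * (t - t₁)) / 3 :=
    (min_le_right _ _).trans (min_le_left _ _)
  have hκ3 : κ ≤ ((lam + η) * (t₂ - t) - (shape t₂ - shape t)) / 3 :=
    (min_le_right _ _).trans (min_le_right _ _)
  set D : ℝ → ∀ n : ℕ, Set (Fin (n + 1) → ℝ) := fun s n =>
    {a | κ ≤ |-Real.log (extend a ⌊s * n⌋₊) - shape s|}
  have hD : Tendsto (fun n => uniformModel n (D t₁ n) + uniformModel n (D t n) +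
      uniformModel n (D t₂ n)) atTop (𝓝 0) := by
    have := ((tendsto_uniformModel_abs_sub_shape h1 (h1'.trans ht') hκ).add
      (tendsto_uniformModel_abs_sub_shape ht ht' hκ)).add
      (tendsto_uniformModel_abs_sub_shape (ht.trans h2) h2' hκ)
    simpa using this
  have lim1 := ((tendsto_floor_div (by linarith : 0 ≤ t)).sub
    (tendsto_floor_div (by linarith : 0 ≤ t₁))).const_mul (lam - η)
  have lim2 := ((tendsto_floor_div (by linarith : 0 ≤ t₂)).sub
    (tendsto_floor_div (by linarith : 0 ≤ t))).const_mul (lam + η)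
  refine tendsto_of_tendsto_of_tendsto_of_le_of_le' tendsto_const_nhds hD
    (Eventually.of_forall fun _ => zero_le) ?_
  filter_upwards [eventually_gt_atTop 0, eventually_floor_lt_floor (by linarith) h1',
    eventually_floor_lt_floor (by linarith) h2,
    lim1.eventually_lt_const (show _ < shape t - shape t₁ - 2 * κ by linarith),
    lim2.eventually_const_lt (show shape t₂ - shape t + 2 * κ < _ by linarith)]
    with n hn0 hpq hqr hl1 hl2
  have hn : (0 : ℝ) < n := by exact_mod_cast hn0
  set p := ⌊t₁ * n⌋₊
  set q := ⌊t * n⌋₊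
  set r := ⌊t₂ * n⌋₊
  have hr : r ≤ n := by
    refine Nat.floor_le_of_le ?_
    nlinarith
  refine le_trans ?_ ((measure_union_le _ _).trans (add_le_add_left (measure_union_le _ _) _))
  refine measure_mono_ae ?_
  filter_upwards [ae_uniformModel_mem n] with a ha ⟨i, hi⟩
  change a ∈ D t₁ n ∪ D t n ∪ D t₂ n
  by_contra hcon
  simp only [Set.mem_union, not_or] at hcon
  obtain ⟨⟨d1, d⟩, d2⟩ := hcon
  simp only [D, Set.mem_ofPred_eq, not_le, abs_lt] at d1 d d2
  have hconv := convexSeq_neg_log ha.1 fun i => (ha.2 i).1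
  set g : ℕ → ℝ := fun k => -Real.log (extend a k)
  change -κ < g p - _ ∧ g p - _ < κ at d1
  change -κ < g q - _ ∧ g q - _ < κ at d
  change -κ < g r - _ ∧ g r - _ < κ at d2
  have e1 : (lam - η) * ((q : ℝ) - p) ≤ n * (g q - g p) := by
    have : (lam - η) * ((q : ℝ) / n - p / n) = (lam - η) * ((q : ℝ) - p) / n := by ring
    rw [this, div_lt_iff₀ hn] at hl1
    nlinarith
  have e2 : n * (g r - g q) ≤ (lam + η) * ((r : ℝ) - q) := by
    have : (lam + η) * ((r : ℝ) / n - q / n) = (lam + η) * ((r : ℝ) - q) / n := by ring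
    rw [this, lt_div_iff₀ hn] at hl2
    nlinarith
  have e3 := hconv.mul_sub_le hpq hqr hr hη.le e1 e2 (Nat.lt_succ_iff.1 i.2)
  have e4 := neg_log_eq_of_lt (ha.2 i).1 hi
  have e5 : g i = -Real.log (a i) := by simp only [g, extend_coe]
  rw [← e5, potential_eq hlam.le] at e4
  have e6 : (q : ℝ) ≤ t * n := Nat.floor_le (by positivity)
  have e7 : lam * q ≤ lam * (t * n) := by gcongr
  have e8 : (n : ℝ) * (shape t - κ) ≤ n * g q := by gcongr; linarith
  have e9 : η * n + κ * n ≤ ε * n := by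
    have : η + κ ≤ ε := by simp only [η] at hκ1 ⊢; linarith
    nlinarith
  change n * (lam * t - shape t + ε) < _ at e4
  linarith

/-- For `lam = 0` the peak is `1 / 2`, outside the range of the limit law, but the coefficients are
below 1 anyway. -/
lemma uniformModel_largeTerm_zero (n : ℕ) {ε : ℝ} (hε : 0 < ε) :
    uniformModel n {a | (fun i => a i ^ n) ∈ largeTerm n 0 ε} = 0 := by
  refine measure_mono_null_ae (t := ∅) ?_ measure_empty
  filter_upwards [ae_uniformModel_mem n] with a ha ⟨i, hi⟩
  exfalso
  have h1 := neg_log_eq_of_lt (ha.2 i).1 hi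
  have h2 : Real.log (a i) ≤ 0 := Real.log_nonpos (ha.2 i).1.le (ha.2 i).2.le
  have hn : (0 : ℝ) ≤ n := by positivity
  rw [potential_zero] at h1
  nlinarith [mul_nonneg hn hε.le]

/-! ### Reversal of the coefficients -/

/-- The sequence read backwards. -/
def reverse {n : ℕ} (a : Fin (n + 1) → ℝ) : Fin (n + 1) → ℝ := fun i => a i.rev

lemma measurable_reverse {n : ℕ} : Measurable (reverse (n := n)) := by
  unfold reverse; fun_prop

lemma map_reverse_iidUniform (n : ℕ) : (iidUniform n).map reverse = iidUniform n := by
  refine (Measure.pi_eq fun s hs => ?_).symm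
  rw [Measure.map_apply measurable_reverse (MeasurableSet.univ_pi hs)]
  have : reverse ⁻¹' Set.univ.pi s = Set.univ.pi fun i => s i.rev := by
    ext a
    simp only [Set.mem_preimage, Set.mem_univ_pi, reverse]
    exact ⟨fun h i => by simpa using h i.rev, fun h i => by simpa using h i.rev⟩
  rw [this, iidUniform, Measure.pi_pi]
  exact Fintype.prod_equiv Fin.revPerm _ _ fun i => rfl

lemma reverse_preimage_logConcaveSet (n : ℕ) : reverse ⁻¹' logConcaveSet n = logConcaveSet n := by
  have key : ∀ a : Fin (n + 1) → ℝ, a ∈ logConcaveSet n → reverse a ∈ logConcaveSet n := by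
    intro a ha i j k hij hjk
    have := ha k.rev j.rev i.rev (by simp only [Fin.val_rev]; omega)
      (by simp only [Fin.val_rev]; omega)
    rw [mul_comm]; exact this
  refine Set.Subset.antisymm (fun a ha => ?_) fun a ha => key a ha
  have := key _ ha
  have e : reverse (reverse a) = a := by ext i; simp [reverse]
  rwa [e] at this

lemma uniformModel_reverse {n : ℕ} {A : Set (Fin (n + 1) → ℝ)} (hA : MeasurableSet A) :
    uniformModel n (reverse ⁻¹' A) = uniformModel n A := by
  have hK := measurableSet_logConcaveSet n
  rw [uniformModel, cond_apply hK, cond_apply hK]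
  congr 1
  conv_rhs => rw [← map_reverse_iidUniform, Measure.map_apply measurable_reverse (hK.inter hA),
    Set.preimage_inter, reverse_preimage_logConcaveSet]

lemma measurable_pow_coeff (n : ℕ) : Measurable fun (a : Fin (n + 1) → ℝ) i => a i ^ n := by
  fun_prop

theorem tendsto_uniformModel_largeTerm (lam : ℝ) {ε : ℝ} (hε : 0 < ε) :
    Tendsto (fun n : ℕ => uniformModel n {a | (fun i => a i ^ n) ∈ largeTerm n lam ε})
      atTop (𝓝 0) := by
  rcases lt_trichotomy lam 0 with h | rfl | h
  · refine (tendsto_uniformModel_largeTerm_of_pos (neg_pos.2 h) hε).congr fun n => ?_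
    refine (uniformModel_reverse (A := {a | (fun i => a i ^ n) ∈ largeTerm n (-lam) ε})
      (measurable_pow_coeff n (measurableSet_largeTerm n (-lam) ε))).symm.trans ?_
    congr 1
    ext a
    have key : ∀ i : Fin (n + 1), Real.exp (n * (potential (-lam) + ε)) <
        |reverse a i ^ n| * Real.exp (-lam * i) ↔
        Real.exp (n * (potential lam + ε)) < |a i.rev ^ n| * Real.exp (lam * i.rev) := by
      intro i
      have hi : ((i.rev : ℕ) : ℝ) = n - i := by
        rw [Fin.val_rev, Nat.cast_sub (by omega)]; push_cast; ring
      have e1 : Real.exp (n * (potential lam + ε)) =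
          Real.exp (n * (potential (-lam) + ε)) * Real.exp (n * lam) := by
        rw [← Real.exp_add, potential_neg]; congr 1; ring
      have e2 : Real.exp (lam * (n - i)) = Real.exp (-lam * i) * Real.exp (n * lam) := by
        rw [← Real.exp_add]; congr 1; ring
      rw [hi, e1, e2, ← mul_assoc, mul_lt_mul_iff_left₀ (Real.exp_pos _)]
      rfl
    constructor
    · rintro ⟨i, hi⟩
      exact ⟨i.rev, (key i).1 hi⟩
    · rintro ⟨i, hi⟩
      exact ⟨i.rev, (key i.rev).2 (by simpa using hi)⟩
  · simp_rw [uniformModel_largeTerm_zero _ hε]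
    exact tendsto_const_nhds
  · exact tendsto_uniformModel_largeTerm_of_pos h hε

/-! ### Anti-concentration of the value of the polynomial -/

/-- A crude mean value bound; the hypotheses force `α ≤ 1`, which permits exponent `n` in place of
`n - 1`. -/
lemma abs_sub_mul_pow_le {n : ℕ} (hn : n ≠ 0) {α s s' : ℝ} (hα : 0 < α) (hs : α ≤ s) (hs' : α ≤ s')
    (hs1 : s ≤ 1) (hs1' : s' ≤ 1) : |s - s'| * α ^ n ≤ |s ^ n - s' ^ n| := by
  wlog h : s' ≤ s generalizing s s'
  · rw [abs_sub_comm, abs_sub_comm (s ^ n)]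
    exact this hs' hs hs1' hs1 (not_le.1 h).le
  obtain ⟨k, rfl⟩ := Nat.exists_eq_succ_of_ne_zero hn
  have hs0 : 0 < s' := hα.trans_le hs'
  have h1 : α ^ (k + 1) ≤ s' ^ k := by
    calc α ^ (k + 1) = α ^ k * α := pow_succ _ _
      _ ≤ s' ^ k * 1 := by gcongr; linarith
      _ = s' ^ k := mul_one _
  have h2 : s' ^ k ≤ s ^ k := by gcongr
  have h3 : 0 ≤ s - s' := by linarith
  rw [abs_of_nonneg h3, Nat.succ_eq_add_one]
  calc (s - s') * α ^ (k + 1) ≤ (s - s') * s' ^ k := by gcongr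
    _ ≤ s ^ (k + 1) - s' ^ (k + 1) := by
      rw [pow_succ, pow_succ]; nlinarith
    _ ≤ _ := le_abs_self _

lemma evalPoly_update_sub {n : ℕ} (x : Fin (n + 1) → ℝ) (i : Fin (n + 1)) (s s' : ℝ) (z : ℂ) :
    evalPoly (fun j => Function.update x i s j ^ n) z -
      evalPoly (fun j => Function.update x i s' j ^ n) z =
        ((s ^ n - s' ^ n : ℝ) : ℂ) * z ^ (i : ℕ) := by
  rw [evalPoly, evalPoly, ← Finset.sum_sub_distrib, Finset.sum_eq_single i]
  · simp only [Function.update_self]; push_cast; ring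
  · intro j _ hj
    simp [Function.update_of_ne hj]
  · simp

/-- The vectors for which the `i`-th coefficient is not small, strictly log-concave, and yet the
polynomial is small at `z`. -/
def smallValue (n : ℕ) (i : ℕ) (z : ℂ) (α q δ : ℝ) : Set (Fin (n + 1) → ℝ) :=
  {a | a ∈ logConcaveSet n ∧ (∀ j, 0 < a j) ∧ α ≤ extend a i ∧ extend a i < 1 ∧
    extend a (i - 1) * extend a (i + 1) ≤ q ^ 2 * extend a i ^ 2 ∧
    ‖evalPoly (fun j => a j ^ n) z‖ ≤ δ}

lemma measurable_evalPoly {n : ℕ} (z : ℂ) :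
    Measurable fun b : Fin (n + 1) → ℝ => evalPoly b z := by
  unfold evalPoly; fun_prop

lemma measurable_evalPoly_pow {n : ℕ} (z : ℂ) :
    Measurable fun a : Fin (n + 1) → ℝ => ‖evalPoly (fun j => a j ^ n) z‖ :=
  ((measurable_evalPoly z).comp (measurable_pow_coeff n)).norm

lemma measurableSet_smallValue (n i : ℕ) (z : ℂ) (α q δ : ℝ) :
    MeasurableSet (smallValue n i z α q δ) := by
  have h1 := measurable_extend (n := n) i
  have h2 := measurable_extend (n := n) (i - 1)
  have h3 := measurable_extend (n := n) (i + 1)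
  refine (measurableSet_logConcaveSet n).inter ((measurableSet_forall_pos n).inter
    ((measurableSet_le measurable_const h1).inter ((measurableSet_lt h1 measurable_const).inter
    ((measurableSet_le (h2.mul h3) ((h1.pow_const 2).const_mul _)).inter
      (measurableSet_le (measurable_evalPoly_pow z) measurable_const)))))

/-- Lowering `a i` helps the inequalities in which it is an outer term; the one centred at `i` has a
factor `q ^ 2` to spare. -/
lemma update_mem_logConcaveSet {n : ℕ} {a : Fin (n + 1) → ℝ} (ha : a ∈ logConcaveSet n)
    (h0 : ∀ j, 0 < a j) {i : Fin (n + 1)} (hi0 : 0 < (i : ℕ)) (hin : (i : ℕ) < n)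
    {q s : ℝ} (hq : 0 < q)
    (hqa : extend a (i - 1) * extend a (i + 1) ≤ q ^ 2 * extend a i ^ 2) (hs : q * a i ≤ s)
    (hs' : s ≤ a i) : Function.update a i s ∈ logConcaveSet n := by
  have hai := h0 i
  intro j k l hjk hkl
  rw [extend_coe] at hqa
  by_cases hj : j = i
  · subst hj
    rw [Function.update_self, Function.update_of_ne (by intro h; omega),
      Function.update_of_ne (by intro h; omega)]
    exact (mul_le_mul_of_nonneg_right hs' (h0 l).le).trans (ha j k l hjk hkl)
  by_cases hk : k = i
  · subst hk
    rw [Function.update_self, Function.update_of_ne (by intro h; omega),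
      Function.update_of_ne (by intro h; omega)]
    rw [show (k : ℕ) - 1 = j by omega, show (k : ℕ) + 1 = l by omega, extend_coe, extend_coe] at hqa
    refine hqa.trans ?_
    rw [← mul_pow]
    have := mul_pos hq hai
    gcongr
  by_cases hl : l = i
  · subst hl
    rw [Function.update_self, Function.update_of_ne hj, Function.update_of_ne hk]
    exact (mul_le_mul_of_nonneg_left hs' (h0 j).le).trans (ha j k l hjk hkl)
  · rw [Function.update_of_ne hj, Function.update_of_ne hk, Function.update_of_ne hl]
    exact ha j k l hjk hkl

/-- Two points of the slice give values of the polynomial differing by `(s ^ n - s' ^ n) z ^ i`, of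
modulus at most `2 δ`; this bounds the diameter. -/
lemma volume_smallValue_slice_le {n : ℕ} (hn : n ≠ 0) (i : Fin (n + 1)) {z : ℂ} (hz : z ≠ 0)
    {α q δ : ℝ} (hα : 0 < α) (x : Fin (n + 1) → ℝ) :
    volume {s | Function.update x i s ∈ smallValue n i z α q δ} ≤
      ENNReal.ofReal (2 * δ / (‖z‖ ^ (i : ℕ) * α ^ n)) := by
  have hz' : 0 < ‖z‖ := norm_pos_iff.2 hz
  refine (Real.volume_le_diam _).trans (Metric.ediam_le fun s hs s' hs' => ?_)
  rw [edist_dist, Real.dist_eq]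
  refine ENNReal.ofReal_le_ofReal ?_
  obtain ⟨-, -, a1, a2, -, a3⟩ := hs
  obtain ⟨-, -, b1, b2, -, b3⟩ := hs'
  rw [extend_coe, Function.update_self] at a1 a2 b1 b2
  have h1 := norm_sub_le (evalPoly (fun j => Function.update x i s j ^ n) z)
    (evalPoly (fun j => Function.update x i s' j ^ n) z)
  rw [evalPoly_update_sub, norm_mul, norm_pow, Complex.norm_real, Real.norm_eq_abs] at h1
  have h2 := abs_sub_mul_pow_le hn hα a1 b1 a2.le b2.le
  rw [le_div_iff₀ (by positivity)]
  calc |s - s'| * (‖z‖ ^ (i : ℕ) * α ^ n) = |s - s'| * α ^ n * ‖z‖ ^ (i : ℕ) := by ring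
    _ ≤ |s ^ n - s' ^ n| * ‖z‖ ^ (i : ℕ) := by gcongr
    _ ≤ 2 * δ := by linarith

/-- The comparison is made on each line parallel to the `i`-th axis, then integrated. If the bad
slice contains some `s₀`, the log-concave slice contains `[q s₀, s₀]`, of length at least `(1 - q)
α`. -/
lemma iidUniform_smallValue_le {n : ℕ} (i : Fin (n + 1)) (hi0 : 0 < (i : ℕ)) (hin : (i : ℕ) < n)
    {z : ℂ} (hz : z ≠ 0) {α q δ : ℝ} (hα : 0 < α) (hq : 0 < q) (hq1 : q < 1) (hδ : 0 ≤ δ) :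
    iidUniform n (smallValue n i z α q δ) ≤
      ENNReal.ofReal (2 * δ / (‖z‖ ^ (i : ℕ) * α ^ n) / ((1 - q) * α)) *
        iidUniform n (logConcaveSet n) := by
  have hn : n ≠ 0 := by omega
  have hz' : 0 < ‖z‖ := norm_pos_iff.2 hz
  set c := 2 * δ / (‖z‖ ^ (i : ℕ) * α ^ n)
  have hc : 0 ≤ c := by positivity
  set ρ := c / ((1 - q) * α)
  have hq' : 0 < 1 - q := by linarith
  have hB := measurableSet_smallValue n i z α q δ
  have hK := measurableSet_logConcaveSet n
  rw [← lintegral_indicator_one hB, ← lintegral_indicator_one hK,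
    ← lintegral_const_mul _ (measurable_one.indicator hK)]
  refine lintegral_le_of_lmarginal_le {i} (measurable_one.indicator hB)
    ((measurable_one.indicator hK).const_mul _) fun x => ?_
  rw [lmarginal_singleton, lmarginal_singleton]
  have hupd : Measurable fun s : ℝ => Function.update x i s := measurable_update x
  have hBs : MeasurableSet {s | Function.update x i s ∈ smallValue n i z α q δ} := hupd hB
  have hKs : MeasurableSet {s | Function.update x i s ∈ logConcaveSet n} := hupd hK
  have e1 : ∫⁻ s in Set.Ioo (0 : ℝ) 1, (smallValue n i z α q δ).indicator 1 (Function.update x i s)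
      ≤ volume {s | Function.update x i s ∈ smallValue n i z α q δ} := by
    refine (setLIntegral_le_lintegral _ _).trans ?_
    rw [← lintegral_indicator_one hBs]
    exact le_of_eq (lintegral_congr fun s => rfl)
  refine e1.trans ?_
  rcases Set.eq_empty_or_nonempty {s | Function.update x i s ∈ smallValue n i z α q δ}
    with h | ⟨s₀, hs₀⟩
  · rw [h, measure_empty]; exact zero_le
  refine (volume_smallValue_slice_le hn i hz hα x).trans ?_
  change _ ≤ ∫⁻ s in Set.Ioo (0 : ℝ) 1, ENNReal.ofReal ρ *
    (logConcaveSet n).indicator 1 (Function.update x i s)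
  rw [lintegral_const_mul' _ _ ENNReal.ofReal_ne_top]
  obtain ⟨b1, b2, b3, b4, b5, -⟩ := hs₀
  have hself : Function.update x i s₀ i = s₀ := Function.update_self ..
  have b3' := b3
  have b4' := b4
  rw [extend_coe, hself] at b3' b4'
  have hs0 : 0 < s₀ := hα.trans_le b3'
  have hsub : Set.Icc (q * s₀) s₀ ⊆
      {s | Function.update x i s ∈ logConcaveSet n} ∩ Set.Ioo 0 1 := by
    intro s hs
    refine ⟨?_, (mul_pos hq hs0).trans_le hs.1, hs.2.trans_lt b4'⟩
    have := update_mem_logConcaveSet b1 b2 hi0 hin hq b5 (s := s) (by rw [hself]; exact hs.1)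
      (by rw [hself]; exact hs.2)
    rwa [Function.update_idem] at this
  have e2 : ENNReal.ofReal ((1 - q) * α) ≤ ∫⁻ s in Set.Ioo (0 : ℝ) 1,
      (logConcaveSet n).indicator 1 (Function.update x i s) := by
    calc ENNReal.ofReal ((1 - q) * α) ≤ ENNReal.ofReal (s₀ - q * s₀) := by
          refine ENNReal.ofReal_le_ofReal ?_
          nlinarith
      _ = volume (Set.Icc (q * s₀) s₀) := Real.volume_Icc.symm
      _ ≤ volume ({s | Function.update x i s ∈ logConcaveSet n} ∩ Set.Ioo 0 1) := measure_mono hsub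
      _ = (volume.restrict (Set.Ioo 0 1)) {s | Function.update x i s ∈ logConcaveSet n} :=
          (Measure.restrict_apply hKs).symm
      _ = _ := by
          rw [← lintegral_indicator_one hKs]
          exact lintegral_congr fun s => rfl
  calc ENNReal.ofReal c = ENNReal.ofReal ρ * ENNReal.ofReal ((1 - q) * α) := by
        rw [← ENNReal.ofReal_mul (by positivity)]
        congr 1; simp only [ρ]; field_simp
    _ ≤ _ := by gcongr

lemma uniformModel_smallValue_le {n : ℕ} {i : ℕ} (hi0 : 0 < i) (hin : i < n)
    {z : ℂ} (hz : z ≠ 0) {α q δ : ℝ} (hα : 0 < α) (hq : 0 < q) (hq1 : q < 1) (hδ : 0 ≤ δ) :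
    uniformModel n (smallValue n i z α q δ) ≤
      ENNReal.ofReal (2 * δ / (‖z‖ ^ i * α ^ n) / ((1 - q) * α)) := by
  have h := iidUniform_smallValue_le ⟨i, by omega⟩ hi0 hin hz hα hq hq1 hδ
  simp only at h
  rw [uniformModel, cond_apply (measurableSet_logConcaveSet n)]
  set R := ENNReal.ofReal (2 * δ / (‖z‖ ^ i * α ^ n) / ((1 - q) * α))
  set K := iidUniform n (logConcaveSet n)
  calc K⁻¹ * iidUniform n (logConcaveSet n ∩ smallValue n i z α q δ) ≤ K⁻¹ * (R * K) := by
        gcongr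
        exact (measure_mono Set.inter_subset_right).trans h
    _ = R * (K⁻¹ * K) := by ring
    _ ≤ R * 1 := by
        gcongr
        exact ENNReal.inv_mul_le_one K
    _ = R := mul_one R

/-! ### Lower bound for the value of the polynomial -/

lemma tendsto_pow_mul_exp_neg (k : ℕ) {c : ℝ} (hc : 0 < c) :
    Tendsto (fun n : ℕ => ((n : ℝ) + 1) ^ k * Real.exp (-(c * n))) atTop (𝓝 0) := by
  have h1 : Tendsto (fun n : ℕ => (n : ℝ) + 1) atTop atTop :=
    tendsto_atTop_add_const_right _ _ tendsto_natCast_atTop_atTop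
  have h2 := ((tendsto_rpow_mul_exp_neg_mul_atTop_nhds_zero k c hc).comp h1).mul_const (Real.exp c)
  rw [zero_mul] at h2
  refine h2.congr fun n => ?_
  simp only [Function.comp, Real.rpow_natCast]
  rw [mul_assoc, ← Real.exp_add]
  congr 2; ring

lemma exp_neg_le_sq {κ : ℝ} (h0 : 0 ≤ κ) (h1 : κ ≤ 1) : Real.exp (-κ) ≤ (1 - κ / 4) ^ 2 := by
  have h2 : Real.exp (-(κ / 2)) ≤ 1 - κ / 4 := by
    rw [Real.exp_neg, inv_le_comm₀ (Real.exp_pos _) (by linarith)]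
    refine le_trans ?_ (Real.add_one_le_exp (κ / 2))
    rw [inv_le_iff_one_le_mul₀ (by linarith)]
    nlinarith
  calc Real.exp (-κ) = Real.exp (-(κ / 2)) ^ 2 := by
        rw [← Real.exp_nat_mul]; congr 1; push_cast; ring
    _ ≤ _ := by gcongr

/-- Choosing `t` slightly to the right of the peak keeps `1 / 2 < t` even for `lam = 0`. -/
lemma exists_shape_near {lam ε : ℝ} (hlam : 0 ≤ lam) (hε : 0 < ε) :
    ∃ t, 1 / 2 < t ∧ t < 1 ∧ potential lam - ε < lam * t - shape t := by
  have hcont : ContinuousAt (fun t => lam * t - shape t) (peak lam) :=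
    (continuousAt_const.mul continuousAt_id).sub (hasDerivAt_shape hlam).continuousAt
  have h1 : Tendsto (fun t => lam * t - shape t) (𝓝[>] peak lam) (𝓝 (potential lam)) := by
    rw [potential_eq hlam]; exact hcont.mono_left nhdsWithin_le_nhds
  obtain ⟨t, ht, ht'⟩ := ((h1.eventually_const_lt (sub_lt_self _ hε)).and
    (Ioo_mem_nhdsGT (peak_lt_one hlam))).exists
  exact ⟨t, (half_le_peak hlam).trans_lt ht'.1, ht'.2, ht⟩

lemma tendsto_uniformModel_norm_le_of_one_le {z : ℂ} (hz : 1 ≤ ‖z‖) {ε : ℝ} (hε : 0 < ε) :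
    Tendsto (fun n : ℕ => uniformModel n {a | ‖evalPoly (fun i => a i ^ n) z‖ ≤
      Real.exp (n * (potential (Real.log ‖z‖) - ε))}) atTop (𝓝 0) := by
  set lam := Real.log ‖z‖
  have hlam : 0 ≤ lam := Real.log_nonneg hz
  have hz0 : 0 < ‖z‖ := by linarith
  have hzne : z ≠ 0 := norm_pos_iff.1 hz0
  have hε8 : 0 < ε / 8 := by positivity
  obtain ⟨t, ht, ht1, htp⟩ := exists_shape_near hlam hε8
  set α := Real.exp (-(shape t + ε / 8))
  have hα : 0 < α := Real.exp_pos _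
  set δ : ℕ → ℝ := fun n => Real.exp (n * (potential lam - ε))
  set κ : ℕ → ℝ := fun n => 1 / ((n : ℝ) + 1) ^ 3
  have hκ0 : ∀ n, 0 < κ n := fun n => by simp only [κ]; positivity
  have hκ1 : ∀ n, κ n ≤ 1 := fun n => by
    simp only [κ]
    rw [div_le_one (by positivity)]
    exact one_le_pow₀ (by linarith [(Nat.cast_nonneg n : (0 : ℝ) ≤ n)])
  have hlim : Tendsto (fun n : ℕ => ENNReal.ofReal (8 * Real.exp lam / α *
      (((n : ℝ) + 1) ^ 3 * Real.exp (-(ε / 2 * n))))) atTop (𝓝 0) := by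
    have := ENNReal.tendsto_ofReal
      ((tendsto_pow_mul_exp_neg 3 (half_pos hε)).const_mul (8 * Real.exp lam / α))
    rwa [mul_zero, ENNReal.ofReal_zero] at this
  have hsum := ((tendsto_uniformModel_abs_sub_shape ht ht1 hε8).add
    (tendsto_uniformModel_lt_mul ht ht1)).add hlim
  rw [add_zero, add_zero] at hsum
  refine tendsto_of_tendsto_of_tendsto_of_le_of_le' tendsto_const_nhds hsum
    (Eventually.of_forall fun _ => zero_le) ?_
  have hfl := tendsto_floor_div (by linarith : 0 ≤ t)
  filter_upwards [eventually_gt_atTop 0, hfl.eventually_const_lt (by linarith : 0 < t),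
    hfl.eventually_lt_const ht1] with n hn0 hi0 hin
  have hn : (0 : ℝ) < n := by exact_mod_cast hn0
  set i := ⌊t * n⌋₊
  have hi0' : 0 < i := by
    rcases Nat.eq_zero_or_pos i with h | h
    · rw [h] at hi0; simp at hi0
    · exact h
  have hin' : i < n := by rw [div_lt_one hn] at hin; exact_mod_cast hin
  have hsmall : uniformModel n (smallValue n i z α (1 - κ n / 4) (δ n)) ≤
      ENNReal.ofReal (8 * Real.exp lam / α * (((n : ℝ) + 1) ^ 3 * Real.exp (-(ε / 2 * n)))) := by
    refine (uniformModel_smallValue_le hi0' hin' hzne hα (by linarith [hκ1 n])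
      (by linarith [hκ0 n]) (Real.exp_pos _).le).trans (ENNReal.ofReal_le_ofReal ?_)
    have hzi : ‖z‖ ^ i = Real.exp (lam * i) := by
      rw [mul_comm, Real.exp_nat_mul, Real.exp_log hz0]
    have hαn : α ^ n = Real.exp (n * (-(shape t + ε / 8))) := (Real.exp_nat_mul _ _).symm
    have hti : t * n < i + 1 := Nat.lt_floor_add_one _
    -- The loss `ε` in `δ` outweighs the two errors `ε / 8`, from `t` and from `α`; the factor `exp
    -- lam` pays for rounding `t n` down to `i`.
    have hquot : δ n / (‖z‖ ^ i * α ^ n) ≤ Real.exp lam * Real.exp (-(ε / 2 * n)) := by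
      rw [hzi, hαn, ← Real.exp_add, ← Real.exp_sub, ← Real.exp_add, Real.exp_le_exp]
      have h1 : lam * (t * n) ≤ lam * (i + 1) := by gcongr
      have h2 : (n : ℝ) * (potential lam - ε / 8) ≤ n * (lam * t - shape t) := by gcongr
      have h3 : 0 < n * ε := by positivity
      linarith
    have hα' := hα.ne'
    calc 2 * δ n / (‖z‖ ^ i * α ^ n) / ((1 - (1 - κ n / 4)) * α)
        = 8 / (κ n * α) * (δ n / (‖z‖ ^ i * α ^ n)) := by
          have := (hκ0 n).ne'
          have e : (1 - (1 - κ n / 4)) = κ n / 4 := by ring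
          rw [e]
          field_simp
          ring
      _ ≤ 8 / (κ n * α) * (Real.exp lam * Real.exp (-(ε / 2 * n))) := by
          have := hκ0 n
          gcongr
      _ = _ := by
          simp only [κ]
          field_simp
  refine le_trans ?_ (add_le_add_right hsmall _)
  refine le_trans ?_ ((measure_union_le _ _).trans (add_le_add_left (measure_union_le _ _) _))
  refine measure_mono_ae ?_
  filter_upwards [ae_uniformModel_mem n] with a ha hav
  change a ∈ {a | ε / 8 ≤ |-Real.log (extend a i) - shape t|} ∪
    {a | Real.exp (-κ n) * extend a i ^ 2 < extend a (i - 1) * extend a (i + 1)} ∪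
    smallValue n i z α (1 - κ n / 4) (δ n)
  by_contra hcon
  simp only [Set.mem_union, not_or] at hcon
  obtain ⟨⟨h1, h2⟩, h3⟩ := hcon
  rw [Set.mem_ofPred_eq] at h1 h2
  refine h3 ⟨ha.1, fun j => (ha.2 j).1, ?_, ?_, ?_, hav⟩
  · have h4 : -Real.log (extend a i) < shape t + ε / 8 := by
      have := (abs_lt.1 (not_le.1 h1)).2
      linarith
    have hpos : 0 < extend a i := by rw [extend_of_le _ hin'.le]; exact (ha.2 _).1
    rw [← Real.exp_log hpos]
    exact Real.exp_le_exp.2 (by linarith)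
  · rw [extend_of_le _ hin'.le]; exact (ha.2 _).2
  · refine (not_lt.1 h2).trans ?_
    gcongr
    exact exp_neg_le_sq (hκ0 n).le (hκ1 n)

lemma evalPoly_reverse {n : ℕ} (b : Fin (n + 1) → ℝ) {z : ℂ} (hz : z ≠ 0) :
    evalPoly b z = z ^ n * evalPoly (reverse b) z⁻¹ := by
  rw [evalPoly, evalPoly, Finset.mul_sum]
  refine Fintype.sum_equiv Fin.revPerm _ _ fun i => ?_
  simp only [Fin.revPerm_apply, reverse, Fin.rev_rev]
  have h : z ^ n = z ^ (i : ℕ) * z ^ (i.rev : ℕ) := by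
    rw [← pow_add]; congr 1; rw [Fin.val_rev]; omega
  rw [h, inv_pow]
  have := pow_ne_zero (i.rev : ℕ) hz
  field_simp

theorem tendsto_uniformModel_norm_le {z : ℂ} (hz : z ≠ 0) {ε : ℝ} (hε : 0 < ε) :
    Tendsto (fun n : ℕ => uniformModel n {a | ‖evalPoly (fun i => a i ^ n) z‖ ≤
      Real.exp (n * (potential (Real.log ‖z‖) - ε))}) atTop (𝓝 0) := by
  have hz0 : 0 < ‖z‖ := norm_pos_iff.2 hz
  rcases le_total 1 ‖z‖ with h | h
  · exact tendsto_uniformModel_norm_le_of_one_le h hε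
  have h' : 1 ≤ ‖z⁻¹‖ := by rw [norm_inv]; exact (one_le_inv₀ hz0).2 h
  refine (tendsto_uniformModel_norm_le_of_one_le h' hε).congr fun n => ?_
  refine (uniformModel_reverse (A := {a | ‖evalPoly (fun i => a i ^ n) z⁻¹‖ ≤
      Real.exp (n * (potential (Real.log ‖z⁻¹‖) - ε))})
    (measurableSet_le (measurable_evalPoly_pow _) measurable_const)).symm.trans ?_
  congr 1
  ext a
  change ‖evalPoly (reverse fun i => a i ^ n) z⁻¹‖ ≤ _ ↔ ‖evalPoly (fun i => a i ^ n) z‖ ≤ _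
  rw [evalPoly_reverse _ hz, norm_mul, norm_pow, norm_inv, Real.log_inv, potential_neg]
  have e : Real.exp (n * (potential (Real.log ‖z‖) - ε)) =
      ‖z‖ ^ n * Real.exp (n * (potential (Real.log ‖z‖) - Real.log ‖z‖ - ε)) := by
    nth_rewrite 2 [← Real.exp_log hz0]
    rw [← Real.exp_nat_mul, ← Real.exp_add]
    congr 1; ring
  rw [e, mul_le_mul_iff_right₀ (pow_pos hz0 n)]

/-! ### The logarithmic potential -/

lemma logPotential_of_ne_zero {n : ℕ} {b : Fin (n + 1) → ℝ} {z : ℂ} (h : evalPoly b z ≠ 0) :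
    logPotential b z = ((Real.log ‖evalPoly b z‖ / n : ℝ) : EReal) := by
  rw [logPotential, ← ofReal_norm, ENNReal.log_ofReal_of_pos (norm_pos_iff.2 h), EReal.coe_div]
  rfl

lemma logPotential_of_eq_zero {n : ℕ} (hn : 0 < n) {b : Fin (n + 1) → ℝ} {z : ℂ}
    (h : evalPoly b z = 0) : logPotential b z = ⊥ := by
  rw [logPotential, h, enorm_zero, ENNReal.log_zero]
  exact EReal.bot_div_of_pos_ne_top (by exact_mod_cast hn) (EReal.natCast_ne_top n)

lemma logPotential_sub_le {n : ℕ} (hn : 0 < n) {b : Fin (n + 1) → ℝ} {z : ℂ} {c g : ℝ}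
    (h : ‖evalPoly b z‖ ≤ Real.exp (n * (g + c))) :
    logPotential b z - (g : EReal) ≤ (c : EReal) := by
  by_cases h0 : evalPoly b z = 0
  · rw [logPotential_of_eq_zero hn h0, EReal.bot_sub]; exact bot_le
  · rw [logPotential_of_ne_zero h0, ← EReal.coe_sub, EReal.coe_le_coe_iff, sub_le_iff_le_add,
      div_le_iff₀ (by exact_mod_cast hn), Real.log_le_iff_le_exp (norm_pos_iff.2 h0)]
    convert! h using 2
    ring

lemma abs_logPotential_sub_lt {n : ℕ} (hn : 0 < n) {b : Fin (n + 1) → ℝ} {z : ℂ} {ε g : ℝ}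
    (h : Real.exp (n * (g - ε)) < ‖evalPoly b z‖)
    (h' : logPotential b z - (g : EReal) < (ε : EReal)) :
    (logPotential b z - (g : EReal)).abs < ENNReal.ofReal ε := by
  have hpos : 0 < ‖evalPoly b z‖ := (Real.exp_pos _).trans h
  have hn' : (0 : ℝ) < n := by exact_mod_cast hn
  rw [logPotential_of_ne_zero (norm_pos_iff.1 hpos), ← EReal.coe_sub] at h' ⊢
  rw [EReal.coe_lt_coe_iff] at h'
  rw [← Real.lt_log_iff_exp_lt hpos] at h
  have h1 : g - ε < Real.log ‖evalPoly b z‖ / n := by rw [lt_div_iff₀ hn']; linarith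
  rw [EReal.abs_def, ENNReal.ofReal_lt_ofReal_iff_of_nonneg (abs_nonneg _), abs_lt]
  constructor <;> linarith

/-- Triangle inequality. One `ε` each pays for the terms at `lam`, the shift of `log ‖z‖`, the shift
of the potential, and the number of terms. -/
lemma norm_evalPoly_le {n : ℕ} {b : Fin (n + 1) → ℝ} {z : ℂ} (hz : z ≠ 0) {lam ε : ℝ} (hε : 0 < ε)
    (hlam : |Real.log ‖z‖ - lam| < ε) (hpot : |potential (Real.log ‖z‖) - potential lam| < ε)
    (hn : (n : ℝ) + 1 ≤ Real.exp (ε * n)) (hb : b ∉ largeTerm n lam ε) :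
    ‖evalPoly b z‖ ≤ Real.exp (n * (potential (Real.log ‖z‖) + 4 * ε)) := by
  have hz0 : 0 < ‖z‖ := norm_pos_iff.2 hz
  have hn0 : (0 : ℝ) ≤ n := by positivity
  have hb' : ∀ i : Fin (n + 1),
      |b i| * Real.exp (lam * i) ≤ Real.exp (n * (potential lam + ε)) := by
    intro i
    by_contra h
    exact hb ⟨i, not_le.1 h⟩
  have hterm : ∀ i : Fin (n + 1), ‖(b i : ℂ) * z ^ (i : ℕ)‖ ≤
      Real.exp (n * (potential (Real.log ‖z‖) + 3 * ε)) := by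
    intro i
    have hi : ((i : ℕ) : ℝ) ≤ n := by exact_mod_cast Nat.lt_succ_iff.1 i.2
    have e1 : ‖z‖ ^ (i : ℕ) ≤ Real.exp (lam * i) * Real.exp (n * ε) := by
      rw [← Real.exp_add]
      nth_rewrite 1 [← Real.exp_log hz0]
      rw [← Real.exp_nat_mul, Real.exp_le_exp]
      have h1 := (abs_lt.1 hlam).2
      have h2 : ((i : ℕ) : ℝ) * (Real.log ‖z‖ - lam) ≤ i * ε := by gcongr
      have h3 : ((i : ℕ) : ℝ) * ε ≤ n * ε := by gcongr
      linarith
    rw [norm_mul, norm_pow, Complex.norm_real, Real.norm_eq_abs]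
    calc |b i| * ‖z‖ ^ (i : ℕ) ≤ |b i| * (Real.exp (lam * i) * Real.exp (n * ε)) := by gcongr
      _ = |b i| * Real.exp (lam * i) * Real.exp (n * ε) := by ring
      _ ≤ Real.exp (n * (potential lam + ε)) * Real.exp (n * ε) := by gcongr; exact hb' i
      _ = Real.exp (n * (potential lam + 2 * ε)) := by rw [← Real.exp_add]; congr 1; ring
      _ ≤ _ := by
        have := (abs_lt.1 hpot).1
        refine Real.exp_le_exp.2 (mul_le_mul_of_nonneg_left ?_ hn0)
        linarith
  calc ‖evalPoly b z‖ ≤ ∑ i : Fin (n + 1), ‖(b i : ℂ) * z ^ (i : ℕ)‖ := norm_sum_le _ _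
    _ ≤ ∑ _i : Fin (n + 1), Real.exp (n * (potential (Real.log ‖z‖) + 3 * ε)) :=
        Finset.sum_le_sum fun i _ => hterm i
    _ = ((n : ℝ) + 1) * Real.exp (n * (potential (Real.log ‖z‖) + 3 * ε)) := by
        rw [Finset.sum_const, Finset.card_univ, Fintype.card_fin, nsmul_eq_mul]; push_cast; rfl
    _ ≤ Real.exp (ε * n) * Real.exp (n * (potential (Real.log ‖z‖) + 3 * ε)) := by gcongr
    _ = _ := by rw [← Real.exp_add]; congr 1; ring

lemma exists_potential_net {ε : ℝ} (hε : 0 < ε) (C : ℝ) : ∃ Λ : Finset ℝ,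
    ∀ x ∈ Set.Icc (-C) C, ∃ lam ∈ Λ, |x - lam| < ε ∧ |potential x - potential lam| < ε := by
  obtain ⟨Λ, -, hΛ⟩ := (isCompact_Icc (a := -C) (b := C)).elim_nhds_subcover
    (fun lam => {x | |x - lam| < ε ∧ |potential x - potential lam| < ε}) (by
      intro lam _
      refine Filter.Eventually.and ?_ ?_
      · exact Metric.eventually_nhds_iff.2 ⟨ε, hε, fun y hy => hy⟩
      · exact Metric.tendsto_nhds.1 continuous_potential.continuousAt ε hε)
  refine ⟨Λ, fun x hx => ?_⟩
  have := hΛ hx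
  simp only [Set.mem_iUnion] at this
  obtain ⟨lam, h1, h2⟩ := this
  exact ⟨lam, h1, h2⟩

/-- An upper bound suffices, and `Measure.le_map_apply` gives it for an almost everywhere measurable
`b`. -/
lemma measure_mem_le {Ω : Type*} [MeasurableSpace Ω] {P : Measure Ω} {n : ℕ}
    {b : Ω → Fin (n + 1) → ℝ} (hb : HasLaw b (betaModel n) P) {S : Set (Fin (n + 1) → ℝ)}
    (hS : MeasurableSet S) :
    P {ω | b ω ∈ S} ≤ uniformModel n {a | (fun i => a i ^ n) ∈ S} := by
  refine (Measure.le_map_apply hb.aemeasurable S).trans ?_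
  rw [hb.map_eq, betaModel, Measure.map_apply (measurable_pow_coeff n) hS]
  rfl

/-- The event `largeTerm` depends on `z` only through `lam`, so finitely many such events control
the whole annulus. -/
theorem tendsto_iSup_logPotential {Ω : ℕ → Type*} [∀ n, MeasurableSpace (Ω n)]
    {P : ∀ n, Measure (Ω n)} {b : ∀ n, Ω n → Fin (n + 1) → ℝ}
    (hb : ∀ n, HasLaw (b n) (betaModel n) (P n)) {C : ℝ} (hC : 1 < C) {ε : ℝ} (hε : 0 < ε) :
    Tendsto (fun n : ℕ => P n {ω | (ε : EReal) ≤
      ⨆ z ∈ {z : ℂ | C⁻¹ ≤ ‖z‖ ∧ ‖z‖ ≤ C}, (logPotential (b n ω) z - (G z : EReal))})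
      atTop (𝓝 0) := by
  have hε8 : 0 < ε / 8 := by positivity
  have hC0 : 0 < C := by linarith
  obtain ⟨Λ, hΛ⟩ := exists_potential_net hε8 (Real.log C)
  have hlim : Tendsto (fun n : ℕ => ∑ lam ∈ Λ,
      uniformModel n {a | (fun i => a i ^ n) ∈ largeTerm n lam (ε / 8)}) atTop (𝓝 0) := by
    have := tendsto_finsetSum Λ fun lam _ => tendsto_uniformModel_largeTerm lam hε8
    simpa using this
  refine tendsto_of_tendsto_of_tendsto_of_le_of_le' tendsto_const_nhds hlim
    (Eventually.of_forall fun _ => zero_le) ?_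
  filter_upwards [eventually_gt_atTop 0,
    (tendsto_pow_mul_exp_neg 1 hε8).eventually_lt_const one_pos] with n hn hexp
  have hexp' : (n : ℝ) + 1 ≤ Real.exp (ε / 8 * n) := by
    rw [pow_one, Real.exp_neg, ← div_eq_mul_inv, div_lt_one (Real.exp_pos _)] at hexp
    exact hexp.le
  refine le_trans (measure_mono (t := ⋃ lam ∈ Λ, {ω | b n ω ∈ largeTerm n lam (ε / 8)}) ?_)
    ((measure_biUnion_finset_le _ _).trans (Finset.sum_le_sum fun lam _ =>
      measure_mem_le (hb n) (measurableSet_largeTerm n lam (ε / 8))))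
  intro ω hω
  by_contra hcon
  simp only [Set.mem_iUnion, not_exists] at hcon
  -- The pointwise bound is `4 * (ε / 8) = ε / 2`, not merely `< ε`, because a strict inequality
  -- would not survive the supremum.
  refine absurd (le_trans hω (b := _) (c := ((ε / 2 : ℝ) : EReal)) ?_) ?_
  · refine iSup₂_le fun z hz => ?_
    have hz0 : 0 < ‖z‖ := (inv_pos.2 hC0).trans_le hz.1
    have hzne := norm_pos_iff.1 hz0
    obtain ⟨lam, h1, h2, h3⟩ := hΛ (Real.log ‖z‖) ⟨by
      rw [← Real.log_inv]; exact Real.log_le_log (inv_pos.2 hC0) hz.1, Real.log_le_log hz0 hz.2⟩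
    rw [G_eq_potential hzne]
    refine logPotential_sub_le hn ?_
    have := norm_evalPoly_le hzne hε8 h2 h3 hexp' (hcon lam h1)
    convert! this using 4
    ring
  · rw [EReal.coe_le_coe_iff]; linarith

theorem tendsto_abs_logPotential_sub {Ω : ℕ → Type*} [∀ n, MeasurableSpace (Ω n)]
    {P : ∀ n, Measure (Ω n)} {b : ∀ n, Ω n → Fin (n + 1) → ℝ}
    (hb : ∀ n, HasLaw (b n) (betaModel n) (P n)) {z : ℂ} (hz : z ≠ 0) {ε : ℝ} (hε : 0 < ε) :
    Tendsto (fun n : ℕ => P n {ω | ENNReal.ofReal ε ≤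
      (logPotential (b n ω) z - (G z : EReal)).abs}) atTop (𝓝 0) := by
  have hz0 : 0 < ‖z‖ := norm_pos_iff.2 hz
  set C := max ‖z‖ ‖z‖⁻¹ + 1
  have hC : 1 < C := by
    have : 0 < max ‖z‖ ‖z‖⁻¹ := lt_max_of_lt_left hz0
    simp only [C]; linarith
  have hzC : z ∈ {z : ℂ | C⁻¹ ≤ ‖z‖ ∧ ‖z‖ ≤ C} := by
    constructor
    · rw [inv_le_comm₀ (by linarith) hz0]
      linarith [le_max_right ‖z‖ ‖z‖⁻¹]
    · linarith [le_max_left ‖z‖ ‖z‖⁻¹]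
  have hlim := (tendsto_uniformModel_norm_le hz hε).add (tendsto_iSup_logPotential hb hC hε)
  rw [add_zero] at hlim
  refine tendsto_of_tendsto_of_tendsto_of_le_of_le' tendsto_const_nhds hlim
    (Eventually.of_forall fun _ => zero_le) ?_
  filter_upwards [eventually_gt_atTop 0] with n hn
  set S : Set (Fin (n + 1) → ℝ) :=
    {b | ‖evalPoly b z‖ ≤ Real.exp (n * (potential (Real.log ‖z‖) - ε))}
  have hS : MeasurableSet S := measurableSet_le (measurable_evalPoly z).norm measurable_const
  refine le_trans ?_ (add_le_add_left (measure_mem_le (hb n) hS) _)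
  refine le_trans (measure_mono ?_) (measure_union_le _ _)
  intro ω hω
  by_contra hcon
  simp only [Set.mem_union, not_or] at hcon
  obtain ⟨h1, h2⟩ := hcon
  have h1' : Real.exp (n * (G z - ε)) < ‖evalPoly (b n ω) z‖ := by
    rw [G_eq_potential hz]; exact not_le.1 h1
  refine absurd hω (not_le.2 (abs_logPotential_sub_lt hn h1' ?_))
  exact (le_iSup₂ (f := fun (z : ℂ) (_ : z ∈ {z : ℂ | C⁻¹ ≤ ‖z‖ ∧ ‖z‖ ≤ C}) =>
    logPotential (b n ω) z - (G z : EReal)) z hzC).trans_lt (not_le.1 h2)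

end LogConcavePoly

theorem mainTheorem3
    (Ω : ℕ → Type*) [∀ n, MeasurableSpace (Ω n)]
    (P : ∀ n, Measure (Ω n)) [∀ n, IsProbabilityMeasure (P n)]
    (b : ∀ n, Ω n → Fin (n + 1) → ℝ)
    (hb : ∀ n, HasLaw (b n) (LogConcavePoly.betaModel n) (P n)) :
    (∀ z : ℂ, z ≠ 0 → ∀ ε : ℝ, 0 < ε →
      Tendsto
        (fun n : ℕ => P n {ω | ENNReal.ofReal ε ≤
          (LogConcavePoly.logPotential (b n ω) z - (LogConcavePoly.G z : EReal)).abs})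
        atTop (𝓝 0)) ∧
    (∀ C : ℝ, 1 < C → ∀ ε : ℝ, 0 < ε →
      Tendsto
        (fun n : ℕ => P n {ω | (ε : EReal) ≤
          ⨆ z ∈ {z : ℂ | C⁻¹ ≤ ‖z‖ ∧ ‖z‖ ≤ C},
            (LogConcavePoly.logPotential (b n ω) z - (LogConcavePoly.G z : EReal))})
        atTop (𝓝 0)) :=
  ⟨fun _ hz _ hε => LogConcavePoly.tendsto_abs_logPotential_sub hb hz hε,
    fun _ hC _ hε => LogConcavePoly.tendsto_iSup_logPotential hb hC hε⟩
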